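/- For a compact set $K\subset\mathbb R^n$ and $p>0$ let $$M_p(K,d_2)=\sup_\mu \int_K\int_K \|x-y\|_2^p\,d\mu(x)\,d\mu(y),$$ the supremum being taken over all finite signed Borel measures $\mu$ on $K$ with $\mu(K)=1$, and let $\mathfrak m_p=M_p([-1,1],d_2)$. Let $B_2^n$ be the closed Euclidean unit ball of $\mathbb R^n$, and let $S_{\ell_2}$ be the unit sphere of the real Hilbert space $\ell_2$. Let $0<\alpha<1$. Then $\mathfrak m_{2\alpha}<\infty$, and for every integer $n\ge 1$ there is a smallest real number $R\ge 0$ for which there exists a map $j:B_2^n\to R\cdot S_{\ell_2}$ (the sphere of radius $R$ centred at $0$) with $\|j(x)-j(y)\|_{\ell_2}=\|x-y\|_2^\alpha$ for all $x,y\in B_2^n$. This smallest radius is $$R_n=\sqrt{\frac{\mathfrak m_{2\alpha}\,\pi^{1/2}\,\Gamma\left(\alpha+\frac n2\right)}{2\,\Gamma\left(\alpha+\frac12\right)\Gamma\left(\frac n2\right)}}.$$ Moreover, for fixed $\alpha$ and $n\to\infty$, $$R_n=n^{\alpha/2}\left(\sqrt{\frac{\mathfrak m_{2\alpha}\,\pi^{1/2}}{2^{1+\alpha}\,\Gamma\left(\alpha+\frac12\right)}}+o(1)\right).$$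 -/

import Mathlib

open MeasureTheory Filter Topology
open scoped lp

/-- The `p`-energy integral `∫ ∫ f(x, y) ^ p dμ(x) dμ(y)` of a signed measure `μ` on `K`. -/
noncomputable def energyIntegral {E : Type*} [MeasurableSpace E] (p : ℝ) (K : Set E)
    (f : E → E → ℝ) (μ : SignedMeasure K) : ℝ :=
  ∫ᵛ y, (∫ᵛ x, f (x : E) (y : E) ^ p ∂•μ) ∂•μ

/-- The `p`-maximal energy of `K`: the supremum, in the extended reals, of the `p`-energy
integrals over all finite signed Borel measures on `K` of total mass one. -/
noncomputable def maximalEnergy {E : Type*} [MeasurableSpace E] (p : ℝ) (K : Set E)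
    (f : E → E → ℝ) : EReal :=
  ⨆ μ : {μ : SignedMeasure K // μ Set.univ = 1}, (energyIntegral p K f μ.1 : EReal)

/-- The constant `𝔪_p`, the `p`-maximal energy of the interval `[-1, 1]` for the usual distance. -/
noncomputable def intervalMaximalEnergy (p : ℝ) : EReal :=
  maximalEnergy p (Set.Icc (-1 : ℝ) 1) dist

/-- The metric space `X` embeds isometrically into the sphere of radius `R` of the real Hilbert
space `ℓ²`, with the distance inherited from the norm of `ℓ²`. -/
def EmbedsInHilbertSphere (X : Type*) [PseudoMetricSpace X] (R : ℝ) : Prop :=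
  ∃ j : X → Metric.sphere (0 : ℓ²(ℕ, ℝ)) R, Isometry j

/-- The snowflaked Euclidean unit ball `(B_2^n, d_2 ^ α)`. -/
abbrev SnowflakedBall (n : ℕ) (α : ℝ) (hα₀ : 0 < α) (hα₁ : α < 1) : Type :=
  Metric.Snowflaking (Metric.closedBall (0 : EuclideanSpace ℝ (Fin n)) 1) α hα₀ hα₁.le

/-! Put p = 2α. A constant C with `IsEnergyBound p K C` is one for which the kernel C - d^p is
positive semidefinite on K, hence a Gram kernel ⟨Φ x, Φ y⟩ in ℓ² (`IsEnergyBound.exists_feature`).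
Then ‖Φ x‖² = C and ‖Φ x - Φ y‖² = 2 d^p, so Φ/√2 embeds the snowflake in the sphere of radius
√(C/2). Conversely, an embedding of radius R makes 2R² an energy bound. A signed measure of mass one
has energy C - ‖∫ Φ dμ‖², so the maximal energy is the least energy bound
(`maximalEnergy_eq_leastEnergyBound`). It remains to see that the least bounds of ball and interval
differ by the factor N/L, with N = `normMoment` and L = `linearMoment`.

From interval to ball (`IsEnergyBound.closedBall`): ‖x‖^p is 1/L times the Gaussian average of |⟨x,
g⟩|^p, and projection along g/‖g‖ maps the ball into [-1, 1].

From ball to interval (`IsEnergyBound.of_closedBall`): for radial densities the averaging is an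
equality, and a duality argument transfers it to all discrete measures on the interval. Let C bound
the ball, b = (L/N) C, and let m > b be a bound on the interval with feature map Φ. For radial f, ‖∫
f Φ(x₀)‖² ≥ (m - b)(∫ f)², with x₀ the first coordinate. Hahn–Banach and Riesz give w with ‖w‖² ≤
1/(m - b) and ⟨w, ∫ f Φ(x₀)⟩ = ∫ f. The densities (1 - ‖x‖²)^(k+1) and Weierstrass approximation
force ⟨w, Φ(t) + Φ(-t)⟩ = 2 on [-1, 1]. Cauchy–Schwarz against a symmetrized measure of mass A and
energy I then gives I ≤ b A².

Finiteness on the interval comes from Fourier analysis (`exists_isEnergyBound_Icc`), and the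
asymptotics from Wendel's inequalities for Γ. -/

/-! ### Fourier representation of the energy and finiteness on the interval -/

lemma one_sub_cos_mul_abs_rpow_nonneg (p t v : ℝ) :
    0 ≤ (1 - Real.cos (2 * Real.pi * t * v)) * |v| ^ (-1 - p) :=
  mul_nonneg (by linarith [Real.cos_le_one (2 * Real.pi * t * v)])
    (Real.rpow_nonneg (abs_nonneg _) _)

/-- Near 0 the cosine factor is O(v²), leaving |v|^(1-p), integrable as p < 2; the tail |v|^(-1-p)
is integrable as p > 0. -/
lemma integrable_one_sub_cos_mul_abs_rpow {p : ℝ} (hp₀ : 0 < p) (hp₂ : p < 2) (t : ℝ) :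
    Integrable (fun v : ℝ => (1 - Real.cos (2 * Real.pi * t * v)) * |v| ^ (-1 - p)) := by
  have hmeas : AEStronglyMeasurable
      (fun v : ℝ => (1 - Real.cos (2 * Real.pi * t * v)) * |v| ^ (-1 - p)) volume := by
    apply Measurable.aestronglyMeasurable
    fun_prop
  rw [← integrableOn_univ, ← Set.union_compl_self (Metric.ball (0 : ℝ) 1), integrableOn_union]
  constructor
  · apply integrableOn_ball_of_norm_le_rpow (α := p - 1) (C := (2 * Real.pi * t) ^ 2 / 2) (by simp)
      (by simp; linarith) _ hmeas
    filter_upwards with v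
    rw [Real.norm_of_nonneg (one_sub_cos_mul_abs_rpow_nonneg p t v), Real.norm_eq_abs]
    rcases eq_or_ne v 0 with rfl | hv
    · simp
      positivity
    have hv' : 0 < |v| := abs_pos.2 hv
    have h1 : |v| ^ (-(p - 1)) = v ^ 2 * |v| ^ (-1 - p) := by
      rw [← sq_abs, ← Real.rpow_natCast, ← Real.rpow_add hv']
      congr 1
      push_cast
      ring
    rw [h1, ← mul_assoc]
    gcongr
    have := Real.one_sub_sq_div_two_le_cos (x := 2 * Real.pi * t * v)
    nlinarith
  · refine Integrable.mono' (g := fun v : ℝ => 2 * (2 ^ (1 + p) * (1 + ‖v‖) ^ (-(1 + p)))) ?_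
      hmeas.restrict ?_
    · exact (((integrable_one_add_norm (by simp; linarith)).const_mul _).const_mul _).integrableOn
    · refine (ae_restrict_iff' Metric.isOpen_ball.measurableSet.compl).2 (.of_forall fun v hv => ?_)
      have hv : 1 ≤ |v| := by simpa using hv
      have hv' : 0 < |v| := by linarith
      rw [Real.norm_of_nonneg (one_sub_cos_mul_abs_rpow_nonneg p t v), Real.norm_eq_abs]
      gcongr
      · linarith [Real.neg_one_le_cos (2 * Real.pi * t * v)]
      · have h1 : (2 : ℝ) ^ (1 + p) * (2 * |v|) ^ (-(1 + p)) = |v| ^ (-1 - p) := by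
          rw [Real.mul_rpow (by norm_num) hv'.le, ← mul_assoc, ← Real.rpow_add (by norm_num)]
          simp
          ring_nf
        rw [← h1]
        gcongr 2 ^ (1 + p) * ?_
        apply Real.rpow_le_rpow_of_nonpos <;> linarith

/-- The normalizing constant in the representation of `|t| ^ p` as a mixture of cosines. -/
noncomputable def cosineConstant (p : ℝ) : ℝ :=
  ∫ v : ℝ, (1 - Real.cos (2 * Real.pi * v)) * |v| ^ (-1 - p)

/-- Homogeneity: the substitution of t v for v extracts |t|^p. -/
lemma integral_one_sub_cos_mul_abs_rpow {p : ℝ} (hp₀ : 0 < p) (t : ℝ) :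
    ∫ v : ℝ, (1 - Real.cos (2 * Real.pi * t * v)) * |v| ^ (-1 - p) =
      cosineConstant p * |t| ^ p := by
  rcases eq_or_ne t 0 with rfl | ht
  · simp [Real.zero_rpow hp₀.ne']
  have ht' : 0 < |t| := abs_pos.2 ht
  have h := Measure.integral_comp_mul_left
    (fun v : ℝ => (1 - Real.cos (2 * Real.pi * v)) * |v| ^ (-1 - p)) t
  have h2 : ∀ v : ℝ, (1 - Real.cos (2 * Real.pi * t * v)) * |v| ^ (-1 - p) =
      |t| ^ (1 + p) * ((1 - Real.cos (2 * Real.pi * (t * v))) * |t * v| ^ (-1 - p)) := by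
    intro v
    rw [abs_mul, Real.mul_rpow ht'.le (abs_nonneg v)]
    have : |t| ^ (1 + p) * |t| ^ (-1 - p) = 1 := by
      rw [← Real.rpow_add ht']; ring_nf; simp
    rw [mul_assoc _ t v]
    linear_combination (1 - Real.cos (2 * Real.pi * (t * v))) * |v| ^ (-1 - p) * (-this)
  simp_rw [h2]
  rw [integral_const_mul, h, smul_eq_mul, abs_inv, Real.rpow_add ht', Real.rpow_one,
    cosineConstant]
  field_simp

lemma cosineConstant_pos {p : ℝ} (hp₀ : 0 < p) (hp₂ : p < 2) : 0 < cosineConstant p := by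
  have hint := integrable_one_sub_cos_mul_abs_rpow hp₀ hp₂ 1
  have hnn := one_sub_cos_mul_abs_rpow_nonneg p 1
  simp only [mul_one] at hint hnn
  rw [cosineConstant, integral_pos_iff_support_of_nonneg hnn hint]
  refine lt_of_lt_of_le ?_ (measure_mono (s := Set.Ioo (0 : ℝ) 1) ?_)
  · simp
  · intro v hv
    have h1 : Real.cos (2 * Real.pi * v) ≠ 1 := by
      intro h
      rw [Real.cos_eq_one_iff] at h
      obtain ⟨k, hk⟩ := h
      have : (k : ℝ) = v := by
        have := Real.pi_pos
        field_simp at hk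
        linarith
      rw [← this] at hv
      have h0 : (0 : ℤ) < k := by exact_mod_cast hv.1
      have h1 : k < (1 : ℤ) := by exact_mod_cast hv.2
      omega
    have h2 : |v| ^ (-1 - p) ≠ 0 := (Real.rpow_pos_of_pos (abs_pos.2 hv.1.ne') _).ne'
    exact mul_ne_zero (sub_ne_zero.2 (Ne.symm h1)) h2

/-- The trigonometric sum with frequencies `x i` and weights `a i`. -/
noncomputable def trigSum {ι : Type*} (s : Finset ι) (x a : ι → ℝ) (v : ℝ) : ℂ :=
  ∑ i ∈ s, (a i : ℂ) * Complex.exp (2 * Real.pi * x i * v * Complex.I)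

lemma norm_trigSum_sq {ι : Type*} (s : Finset ι) (x a : ι → ℝ) (v : ℝ) :
    ‖trigSum s x a v‖ ^ 2 =
      ∑ i ∈ s, ∑ j ∈ s, a i * a j * Real.cos (2 * Real.pi * (x i - x j) * v) := by
  have h : ((‖trigSum s x a v‖ ^ 2 : ℝ) : ℂ) = ∑ i ∈ s, ∑ j ∈ s, (a i * a j : ℂ) *
      Complex.exp ((2 * Real.pi * (x i - x j) * v : ℝ) * Complex.I) := by
    push_cast
    rw [← Complex.mul_conj', trigSum, map_sum, Finset.sum_mul_sum]
    refine Finset.sum_congr rfl fun i _ => Finset.sum_congr rfl fun j _ => ?_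
    rw [map_mul, ← Complex.exp_conj]
    simp only [map_mul, Complex.conj_ofReal, Complex.conj_I, map_ofNat]
    rw [mul_mul_mul_comm, ← Complex.exp_add]
    congr 2
    ring
  have := congrArg Complex.re h
  rw [Complex.ofReal_re] at this
  rw [this, Complex.re_sum]
  refine Finset.sum_congr rfl fun i _ => ?_
  rw [Complex.re_sum]
  refine Finset.sum_congr rfl fun j _ => ?_
  rw [← Complex.ofReal_mul, Complex.re_ofReal_mul, Complex.exp_ofReal_mul_I_re]

/-- Total weight zero allows cos to be replaced by cos - 1, which tames the singular weight at v =
0. -/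
lemma norm_trigSum_sq_mul {ι : Type*} (p : ℝ) (s : Finset ι) (x a : ι → ℝ)
    (ha : ∑ i ∈ s, a i = 0) (v : ℝ) :
    ‖trigSum s x a v‖ ^ 2 * |v| ^ (-1 - p) = ∑ i ∈ s, ∑ j ∈ s, -(a i * a j) *
      ((1 - Real.cos (2 * Real.pi * (x i - x j) * v)) * |v| ^ (-1 - p)) := by
  have h0 : ∑ i ∈ s, ∑ j ∈ s, a i * a j = 0 := by
    rw [← Finset.sum_mul_sum, ha, zero_mul]
  have : ‖trigSum s x a v‖ ^ 2 = ∑ i ∈ s, ∑ j ∈ s, -(a i * a j) *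
      (1 - Real.cos (2 * Real.pi * (x i - x j) * v)) := by
    rw [norm_trigSum_sq, ← sub_zero (∑ i ∈ s, ∑ j ∈ s, _), ← h0, ← Finset.sum_sub_distrib]
    refine Finset.sum_congr rfl fun i _ => ?_
    rw [← Finset.sum_sub_distrib]
    exact Finset.sum_congr rfl fun j _ => by ring
  rw [this, Finset.sum_mul]
  refine Finset.sum_congr rfl fun i _ => ?_
  rw [Finset.sum_mul]
  exact Finset.sum_congr rfl fun j _ => by ring

lemma integrable_norm_trigSum_sq_mul {ι : Type*} {p : ℝ} (hp₀ : 0 < p) (hp₂ : p < 2)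
    (s : Finset ι) (x a : ι → ℝ) (ha : ∑ i ∈ s, a i = 0) :
    Integrable (fun v => ‖trigSum s x a v‖ ^ 2 * |v| ^ (-1 - p)) := by
  simp_rw [norm_trigSum_sq_mul p s x a ha]
  exact integrable_finsetSum _ fun i _ => integrable_finsetSum _ fun j _ =>
    (integrable_one_sub_cos_mul_abs_rpow hp₀ hp₂ _).const_mul _

/-- The energy of a discrete signed measure of total mass zero on the line. -/
lemma integral_norm_trigSum_sq_mul {ι : Type*} {p : ℝ} (hp₀ : 0 < p) (hp₂ : p < 2)
    (s : Finset ι) (x a : ι → ℝ) (ha : ∑ i ∈ s, a i = 0) :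
    ∫ v, ‖trigSum s x a v‖ ^ 2 * |v| ^ (-1 - p) =
      -cosineConstant p * ∑ i ∈ s, ∑ j ∈ s, a i * a j * |x i - x j| ^ p := by
  simp_rw [norm_trigSum_sq_mul p s x a ha]
  have hI := fun i j => (integrable_one_sub_cos_mul_abs_rpow hp₀ hp₂ (x i - x j)).const_mul
    (-(a i * a j))
  rw [integral_finsetSum _ fun i _ => integrable_finsetSum _ fun j _ => hI i j, Finset.mul_sum]
  refine Finset.sum_congr rfl fun i _ => ?_
  rw [integral_finsetSum _ fun j _ => hI i j, Finset.mul_sum]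
  refine Finset.sum_congr rfl fun j _ => ?_
  rw [integral_const_mul, integral_one_sub_cos_mul_abs_rpow hp₀]
  ring

open scoped FourierTransform in
/-- A compactly supported smooth function is the Fourier integral of a function whose weighted
`L²` norms are finite. -/
lemma HasCompactSupport.exists_eq_integral_exp {U : ℝ → ℝ} (hU : HasCompactSupport U)
    (hU' : ContDiff ℝ (⊤ : ℕ∞) U) {q : ℝ} (hq₀ : 0 ≤ q) (hq₃ : q ≤ 3) :
    ∃ g : ℝ → ℂ, Integrable g ∧ Integrable (fun v => ‖g v‖ ^ 2 * |v| ^ q) ∧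
      ∀ x, (U x : ℂ) = ∫ v : ℝ, Complex.exp (2 * Real.pi * x * v * Complex.I) * g v := by
  have h1 : HasCompactSupport (fun x => (U x : ℂ)) := hU.comp_left (g := Complex.ofReal) rfl
  have h2 : ContDiff ℝ (⊤ : ℕ∞) (fun x => (U x : ℂ)) := Complex.ofRealCLM.contDiff.comp hU'
  set V := h1.toSchwartzMap h2 with hV
  set g := 𝓕 V with hg
  refine ⟨g, g.integrable, ?_, fun x => ?_⟩
  · have hbd := SchwartzMap.norm_le_seminorm ℝ g
    set C := SchwartzMap.seminorm ℝ 0 0 g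
    have hi := ((g.integrable_pow_mul volume 0).add (g.integrable_pow_mul volume 3)).const_mul C
    refine hi.mono' ?_ (.of_forall fun v => ?_)
    · have := g.continuous
      apply Measurable.aestronglyMeasurable
      fun_prop
    · have h3 : |v| ^ q ≤ 1 + |v| ^ 3 := by
        rcases le_total |v| 1 with h | h
        · have := Real.rpow_le_one (abs_nonneg v) h hq₀
          have := pow_nonneg (abs_nonneg v) 3
          linarith
        · have := Real.rpow_le_rpow_of_exponent_le h hq₃
          rw [show (3 : ℝ) = (3 : ℕ) by norm_num, Real.rpow_natCast] at this
          linarith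
      have h4 : 0 ≤ |v| ^ q := Real.rpow_nonneg (abs_nonneg _) _
      rw [Real.norm_of_nonneg (by positivity)]
      simp only [Pi.add_apply, Real.norm_eq_abs, pow_zero, one_mul]
      calc ‖g v‖ ^ 2 * |v| ^ q = ‖g v‖ * (‖g v‖ * |v| ^ q) := by ring
        _ ≤ C * (‖g v‖ * (1 + |v| ^ 3)) := by gcongr; exact hbd v
        _ = _ := by ring
  · have h3 : 𝓕⁻ g = V := by simp [hg]
    have h4 : (U x : ℂ) = V x := rfl
    rw [h4, ← h3, SchwartzMap.fourierInv_coe, Real.fourierInv_eq']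
    refine integral_congr_ae (.of_forall fun v => ?_)
    simp only [smul_eq_mul]
    congr 2
    simp
    ring

/-- The `p`-th power of the distance to `-2` on `[-1, 1]` is the restriction of a test function. -/
lemma exists_contDiff_eq_abs_add_two_rpow (p : ℝ) : ∃ U : ℝ → ℝ, HasCompactSupport U ∧
    ContDiff ℝ (⊤ : ℕ∞) U ∧ U (-2) = 0 ∧ ∀ x ∈ Set.Icc (-1 : ℝ) 1, U x = |x + 2| ^ p := by
  -- The bump is 1 on [-1, 1] and vanishes beyond 3/2, so the product stays away from the
  -- singularity of the power at -2.
  let f : ContDiffBump (0 : ℝ) := ⟨1, 3 / 2, by norm_num, by norm_num⟩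
  refine ⟨fun x => f x * (x + 2) ^ p, f.hasCompactSupport.mul_right, ?_, ?_, fun x hx => ?_⟩
  · rw [contDiff_iff_contDiffAt]
    intro x
    rcases lt_or_ge (-2) x with hx | hx
    · exact f.contDiffAt.mul ((contDiffAt_id.add contDiffAt_const).rpow_const_of_ne
        (by simp; linarith))
    · have : (fun x => f x * (x + 2) ^ p) =ᶠ[𝓝 x] fun _ => 0 := by
        filter_upwards [Iio_mem_nhds (show x < -(3 / 2) by linarith)] with y hy
        rw [f.zero_of_le_dist, zero_mul]
        simp only [Real.dist_eq, f, sub_zero]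
        rw [abs_of_neg (by linarith [Set.mem_Iio.1 hy])]
        linarith [Set.mem_Iio.1 hy]
      exact contDiffAt_const.congr_of_eventuallyEq this
  · simp only
    rw [f.zero_of_le_dist, zero_mul]
    simp only [Real.dist_eq, f, sub_zero]
    norm_num
  · simp only
    rw [f.one_of_mem_closedBall, one_mul, abs_of_nonneg (by linarith [hx.1])]
    simpa [f, abs_le] using hx

/-- `C` bounds the `p`-energies of discrete signed measures of total mass one on `K`. -/
def IsEnergyBound {E : Type*} [Dist E] (p : ℝ) (K : Set E) (C : ℝ) : Prop :=
  ∀ (ι : Type) (s : Finset ι) (x : ι → E) (a : ι → ℝ), (∀ i, x i ∈ K) →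
    ∑ i ∈ s, ∑ j ∈ s, a i * a j * dist (x i) (x j) ^ p ≤ C * (∑ i ∈ s, a i) ^ 2

/-- Pointwise weighted AM–GM with dual weights w and w'; integrated, it replaces Cauchy–Schwarz. -/
lemma two_mul_mul_mul_le_add {κ : ℝ} (hκ : 0 < κ) (A t g : ℝ) {w w' : ℝ} (hw : 0 < w)
    (hw' : w * w' = 1) : 2 * A * (t * g) ≤ κ⁻¹ * (t ^ 2 * w) + κ * A ^ 2 * (g ^ 2 * w') := by
  have h : 0 ≤ κ⁻¹ * w * (t - κ * A * g * w') ^ 2 := by positivity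
  have e : κ⁻¹ * w * (t - κ * A * g * w') ^ 2 = κ⁻¹ * (t ^ 2 * w) - 2 * A * (t * g) * (w * w') +
      κ * A ^ 2 * (g ^ 2 * (w' * (w * w'))) := by
    field_simp
    ring
  rw [e, hw'] at h
  linarith

/-- The maximal energies of the interval are finite. -/
lemma exists_isEnergyBound_Icc {p : ℝ} (hp₀ : 0 < p) (hp₂ : p < 2) :
    ∃ C : ℝ, 0 ≤ C ∧ IsEnergyBound p (Set.Icc (-1 : ℝ) 1) C := by
  obtain ⟨U, hU, hU', hU2, hUp⟩ := exists_contDiff_eq_abs_add_two_rpow p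
  obtain ⟨g, hg, hg2, hgU⟩ := hU.exists_eq_integral_exp hU' (q := 1 + p) (by linarith) (by linarith)
  have hκ := cosineConstant_pos hp₀ hp₂
  set κ := cosineConstant p
  set G := ∫ v, ‖g v‖ ^ 2 * |v| ^ (1 + p)
  have hG : 0 ≤ G := integral_nonneg fun v =>
    mul_nonneg (by positivity) (Real.rpow_nonneg (abs_nonneg _) _)
  refine ⟨κ * G, by positivity, fun ι s x a hx => ?_⟩
  set A := ∑ i ∈ s, a i
  -- A mass -A placed at -2, outside the interval, makes the total mass zero. It changes the energy
  -- by -2A ∑ a i |x i + 2|^p, a linear term that has to be controlled.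
  let s' := Finset.insertNone s
  let x' : Option ι → ℝ := fun o => o.elim (-2) x
  let a' : Option ι → ℝ := fun o => o.elim (-A) a
  have ha' : ∑ i ∈ s', a' i = 0 := by simp [s', a', A]
  have hI := integrable_norm_trigSum_sq_mul hp₀ hp₂ s' x' a' ha'
  have hE := integral_norm_trigSum_sq_mul hp₀ hp₂ s' x' a' ha'
  have hexp : ∀ t : ℝ, Integrable fun v : ℝ =>
      Complex.exp (2 * Real.pi * t * v * Complex.I) * g v := by
    intro t
    refine hg.bdd_mul (c := 1) (by fun_prop) (.of_forall fun v => ?_)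
    rw [show (2 * Real.pi * t * v * Complex.I : ℂ) = (2 * Real.pi * t * v : ℝ) * Complex.I by
      push_cast; ring, Complex.norm_exp_ofReal_mul_I]
  -- The linear term is a pairing with g, since U(-2) = 0 makes the added mass invisible.
  have hsum : ((∑ i ∈ s, a i * |x i + 2| ^ p : ℝ) : ℂ) = ∫ v, trigSum s' x' a' v * g v := by
    have h1 : ∀ v, trigSum s' x' a' v * g v = ∑ i ∈ s', (a' i : ℂ) *
        (Complex.exp (2 * Real.pi * x' i * v * Complex.I) * g v) := by
      intro v
      rw [trigSum, Finset.sum_mul]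
      exact Finset.sum_congr rfl fun i _ => by ring
    simp_rw [h1]
    rw [integral_finsetSum _ fun i _ => (hexp _).const_mul _]
    simp_rw [integral_const_mul, ← hgU]
    simp only [s', Finset.sum_insertNone, x', a', Option.elim, hU2]
    push_cast
    simp only [mul_zero, zero_add]
    refine Finset.sum_congr rfl fun i _ => ?_
    rw [hUp _ (hx i)]
  have hE' : ∑ i ∈ s', ∑ j ∈ s', a' i * a' j * |x' i - x' j| ^ p =
      (∑ i ∈ s, ∑ j ∈ s, a i * a j * |x i - x j| ^ p) -
        2 * A * ∑ i ∈ s, a i * |x i + 2| ^ p := by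
    have h0 : |(-2 : ℝ) + 2| ^ p = 0 := by
      rw [neg_add_cancel, abs_zero, Real.zero_rpow hp₀.ne']
    simp only [s', Finset.sum_insertNone, x', a', Option.elim, h0, mul_zero, zero_add,
      sub_neg_eq_add, Finset.sum_add_distrib]
    have h1 : ∀ i, |-2 - x i| = |x i + 2| := fun i => by rw [← abs_neg]; ring_nf
    simp_rw [h1]
    have h2 : ∀ i, a i * -A * |x i + 2| ^ p = -A * (a i * |x i + 2| ^ p) := fun i => by ring
    have h3 : ∀ i, -A * a i * |x i + 2| ^ p = -A * (a i * |x i + 2| ^ p) := fun i => by ring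
    simp_rw [h2, h3, ← Finset.mul_sum]
    ring
  have hmain : 2 * A * ∑ i ∈ s, a i * |x i + 2| ^ p ≤
      κ⁻¹ * (∫ v, ‖trigSum s' x' a' v‖ ^ 2 * |v| ^ (-1 - p)) + κ * A ^ 2 * G := by
    calc 2 * A * ∑ i ∈ s, a i * |x i + 2| ^ p
        ≤ 2 * |A| * ‖((∑ i ∈ s, a i * |x i + 2| ^ p : ℝ) : ℂ)‖ := by
          rw [Complex.norm_real, Real.norm_eq_abs, mul_assoc, mul_assoc, ← abs_mul]
          gcongr
          exact le_abs_self _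
      _ ≤ 2 * |A| * ∫ v, ‖trigSum s' x' a' v * g v‖ := by
          rw [hsum]
          gcongr
          exact norm_integral_le_integral_norm _
      _ = ∫ v, 2 * |A| * (‖trigSum s' x' a' v‖ * ‖g v‖) := by
          simp_rw [norm_mul]
          rw [integral_const_mul]
      _ ≤ ∫ v, (κ⁻¹ * (‖trigSum s' x' a' v‖ ^ 2 * |v| ^ (-1 - p)) +
            κ * |A| ^ 2 * (‖g v‖ ^ 2 * |v| ^ (1 + p))) := by
          refine integral_mono_of_nonneg (.of_forall fun v => by positivity)
            ((hI.const_mul _).add (hg2.const_mul _)) ?_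
          -- The two weights are mutually inverse only away from v = 0.
          filter_upwards [compl_mem_ae_iff.2 (measure_singleton (0 : ℝ))] with v hv
          have hv' : 0 < |v| := abs_pos.2 hv
          refine two_mul_mul_mul_le_add hκ _ _ _ (Real.rpow_pos_of_pos hv' _) ?_
          rw [← Real.rpow_add hv']
          ring_nf
          simp
      _ = _ := by
          rw [integral_add (hI.const_mul _) (hg2.const_mul _), integral_const_mul,
            integral_const_mul, sq_abs]
  rw [hE, hE'] at hmain
  simp_rw [Real.dist_eq]
  have : κ⁻¹ * (-κ * ((∑ i ∈ s, ∑ j ∈ s, a i * a j * |x i - x j| ^ p) -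
        2 * A * ∑ i ∈ s, a i * |x i + 2| ^ p)) = -((∑ i ∈ s, ∑ j ∈ s, a i * a j * |x i - x j| ^ p) -
        2 * A * ∑ i ∈ s, a i * |x i + 2| ^ p) := by
    field_simp
  rw [this] at hmain
  linarith

/-! ### Feature maps into ℓ² -/

section Separable

variable {H : Type*} [NormedAddCommGroup H] [InnerProductSpace ℝ H]

/-- Orthonormal vectors lie √2 apart, so balls of radius 1/2 around them are disjoint open sets. -/
lemma Orthonormal.countable_index [TopologicalSpace.SeparableSpace H] {ι : Type*} {v : ι → H}
    (hv : Orthonormal ℝ v) : Countable ι := by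
  have h : (Set.univ : Set ι).PairwiseDisjoint fun i => Metric.ball (v i) (1 / 2) := by
    intro i _ j _ hij
    refine Metric.ball_disjoint_ball ?_
    have h1 : ‖v i - v j‖ ^ 2 = 2 := by
      rw [norm_sub_sq_real, hv.1 i, hv.1 j, hv.2 hij]
      norm_num
    rw [dist_eq_norm]
    nlinarith [norm_nonneg (v i - v j)]
  have := h.countable_of_isOpen (fun i _ => Metric.isOpen_ball)
    (fun i _ => Metric.nonempty_ball.2 (by norm_num))
  exact Set.countable_univ_iff.1 this

lemma exists_linearIsometry_l2 [CompleteSpace H] [TopologicalSpace.SeparableSpace H] :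
    Nonempty (H →ₗᵢ[ℝ] ℓ²(ℕ, ℝ)) := by
  obtain ⟨w, b, -⟩ := exists_hilbertBasis ℝ H
  have hw : Countable w := b.orthonormal.countable_index
  obtain ⟨e, he⟩ := exists_injective_nat w
  have ho : Orthonormal ℝ fun i : w => (lp.single 2 (e i) (1 : ℝ) : ℓ²(ℕ, ℝ)) := by
    classical
    rw [orthonormal_iff_ite]
    intro i j
    rw [lp.inner_single_left]
    simp [lp.single_apply, Pi.single_apply, he.eq_iff]
  exact ⟨ho.orthogonalFamily.linearIsometry.comp b.repr.toLinearIsometry⟩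

end Separable

/-- A positive semidefinite kernel on a set has a feature map into a Hilbert space. -/
lemma exists_inner_eq_of_posSemidef {X : Type} (k : X → X → ℝ) (hsymm : ∀ x y, k x y = k y x)
    (hpos : ∀ f : X →₀ ℝ, 0 ≤ f.sum fun x a => f.sum fun y b => a * b * k x y) :
    ∃ (H : Type) (_ : NormedAddCommGroup H) (_ : InnerProductSpace ℝ H) (_ : CompleteSpace H)
      (Φ : X → H), (Submodule.span ℝ (Set.range Φ)).topologicalClosure = ⊤ ∧
        ∀ x y, inner ℝ (Φ x) (Φ y) = k x y := by
  -- Reproducing kernels here are operator-valued; a real scalar acts as a multiple of the identity.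
  let K : Matrix X X (ℝ →L[ℝ] ℝ) := .of fun x y => k x y • 1
  have hK : K.PosSemidef := by
    have htfae := (RKHS.posSemidef_tfae (K := K)).out 0 2
    refine htfae.2 ⟨?_, fun f => ?_⟩
    · ext x y
      simp [K, hsymm x y]
    · refine (hpos f).trans_eq ?_
      simp only [Finsupp.sum, K, Matrix.of_apply, RCLike.re_to_real]
      refine Finset.sum_congr rfl fun x _ => Finset.sum_congr rfl fun y _ => ?_
      simp [hsymm x y]
      ring
  have : Fact K.PosSemidef := ⟨hK⟩
  refine ⟨RKHS.OfKernel K, inferInstance, inferInstance, inferInstance,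
    fun x => RKHS.kerFun (RKHS.OfKernel K) x 1, ?_, fun x y => ?_⟩
  · have h := RKHS.kerFun_dense (RKHS.OfKernel K)
    rw [eq_top_iff, ← h]
    refine Submodule.topologicalClosure_mono (Submodule.span_le.2 ?_)
    rintro _ ⟨x, v, rfl⟩
    have : RKHS.kerFun (RKHS.OfKernel K) x v = v • RKHS.kerFun (RKHS.OfKernel K) x 1 := by
      rw [← map_smul, smul_eq_mul, mul_one]
    rw [this]
    exact Submodule.smul_mem _ _ (Submodule.subset_span ⟨x, rfl⟩)
  · rw [← RKHS.kernel_inner, RKHS.OfKernel.kernel_ofKernel]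
    simp [K, hsymm x y]

lemma continuous_of_inner_eq {X H : Type*} [PseudoMetricSpace X] [NormedAddCommGroup H]
    [InnerProductSpace ℝ H] {p C : ℝ} (hp : 0 < p) {Φ : X → H}
    (hΦ : ∀ x y, inner ℝ (Φ x) (Φ y) = C - dist x y ^ p) : Continuous Φ := by
  have h : ∀ x y, ‖Φ x - Φ y‖ ^ 2 = 2 * dist x y ^ p := by
    intro x y
    rw [← real_inner_self_eq_norm_sq, inner_sub_left, inner_sub_right, inner_sub_right, hΦ, hΦ,
      hΦ, hΦ, dist_self, dist_self, Real.zero_rpow hp.ne', dist_comm y x]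
    ring
  refine continuous_iff_continuousAt.2 fun y => ?_
  rw [ContinuousAt, tendsto_iff_norm_sub_tendsto_zero]
  have h1 : ∀ x, ‖Φ x - Φ y‖ = √(2 * dist x y ^ p) := fun x => by
    rw [← h, Real.sqrt_sq (norm_nonneg _)]
  simp_rw [h1]
  have : Continuous fun x => √(2 * dist x y ^ p) := by
    have : Continuous fun x => dist x y ^ p :=
      (continuous_id.dist continuous_const).rpow_const fun _ => .inr hp.le
    fun_prop
  simpa [Real.zero_rpow hp.ne'] using this.tendsto y

/-- The bound is positive semidefiniteness of C - d^p written out. Continuity of the feature map and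
separability of E make its closed span separable, so it fits into ℓ². -/
lemma IsEnergyBound.exists_feature {E : Type} [PseudoMetricSpace E] [SecondCountableTopology E]
    {p C : ℝ} (hp : 0 < p) {K : Set E} (hC : IsEnergyBound p K C) :
    ∃ Φ : K → ℓ²(ℕ, ℝ), Continuous Φ ∧ ∀ x y : K, inner ℝ (Φ x) (Φ y) = C - dist x y ^ p := by
  obtain ⟨H, _, _, _, Φ, hΦ, hin⟩ := exists_inner_eq_of_posSemidef
    (fun x y : K => C - dist x y ^ p) (fun x y => by rw [dist_comm]) fun f => by
      have h := hC K f.support (fun x => x) f fun x => x.2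
      have e : (f.sum fun x a => f.sum fun y b => a * b * (C - dist x y ^ p)) =
          C * (∑ x ∈ f.support, f x) ^ 2 - ∑ x ∈ f.support, ∑ y ∈ f.support,
            f x * f y * dist (x : E) (y : E) ^ p := by
        simp only [Finsupp.sum, mul_sub, Finset.sum_sub_distrib, Subtype.dist_eq]
        rw [pow_two, Finset.sum_mul_sum, Finset.mul_sum]
        simp_rw [Finset.mul_sum]
        congr 1
        exact Finset.sum_congr rfl fun _ _ => Finset.sum_congr rfl fun _ _ => by ring
      rw [e]
      linarith
  have hcont : Continuous Φ := continuous_of_inner_eq hp hin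
  have hsep : TopologicalSpace.SeparableSpace H := by
    rw [← TopologicalSpace.isSeparable_univ_iff]
    have := (TopologicalSpace.isSeparable_range hcont).span (R := ℝ) |>.closure
    rwa [← Submodule.topologicalClosure_coe, hΦ, Submodule.top_coe] at this
  obtain ⟨T⟩ := exists_linearIsometry_l2 (H := H)
  exact ⟨T ∘ Φ, T.continuous.comp hcont, fun x y => by
    rw [Function.comp, Function.comp, T.inner_map_map, hin]⟩

/-! ### Gaussian averaging over directions: from the interval to the ball -/

section Radial

variable {V : Type*} [NormedAddCommGroup V] [InnerProductSpace ℝ V] [FiniteDimensional ℝ V]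
  [MeasurableSpace V] [BorelSpace V]

/-- The reflection exchanging x and y preserves norms and Lebesgue measure. -/
lemma integral_inner_norm_eq_of_norm_eq {G : Type*} [NormedAddCommGroup G] [NormedSpace ℝ G]
    (f : ℝ → ℝ → G) {x y : V} (h : ‖x‖ = ‖y‖) :
    ∫ g : V, f (inner ℝ x g) ‖g‖ = ∫ g : V, f (inner ℝ y g) ‖g‖ := by
  set R := Submodule.reflection (ℝ ∙ (x - y))ᗮ
  have hR : R x = y := Submodule.reflection_sub h
  rw [← (R.measurePreserving).integral_comp R.toHomeomorph.measurableEmbedding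
    (fun g => f (inner ℝ y g) ‖g‖)]
  refine integral_congr_ae (.of_forall fun g => ?_)
  simp only [LinearIsometryEquiv.norm_map]
  rw [← hR, LinearIsometryEquiv.inner_map_map]

end Radial

lemma integral_abs_rpow_mul_exp_neg_sq {p : ℝ} (hp : 0 < p) :
    ∫ t : ℝ, |t| ^ p * Real.exp (-t ^ 2) = Real.Gamma ((p + 1) / 2) := by
  have h := integral_comp_abs (f := fun t => t ^ p * Real.exp (-t ^ 2))
  simp only [sq_abs] at h
  have h2 := integral_rpow_mul_exp_neg_rpow (p := 2) (q := p) (by norm_num) (by linarith)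
  simp only [Real.rpow_ofNat] at h2
  rw [h, h2]
  ring

/-- The Gaussian moment of order `p` of a linear form of norm one on Euclidean space. -/
noncomputable def linearMoment (n : ℕ) (p : ℝ) : ℝ :=
  √Real.pi ^ (n - 1) * Real.Gamma ((p + 1) / 2)

/-- The Gaussian moment of order `p` of the norm on Euclidean space. -/
noncomputable def normMoment (n : ℕ) (p : ℝ) : ℝ :=
  √Real.pi ^ n * Real.Gamma ((p + n) / 2) / Real.Gamma (n / 2)

lemma linearMoment_pos (n : ℕ) {p : ℝ} (hp : 0 < p) : 0 < linearMoment n p := by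
  have := Real.Gamma_pos_of_pos (show 0 < (p + 1) / 2 by linarith)
  have := Real.pi_pos
  unfold linearMoment
  positivity

lemma normMoment_pos {n : ℕ} (hn : 1 ≤ n) {p : ℝ} (hp : 0 < p) : 0 < normMoment n p := by
  have hn' : (1 : ℝ) ≤ n := by exact_mod_cast hn
  have := Real.Gamma_pos_of_pos (show 0 < (p + n) / 2 by linarith)
  have := Real.Gamma_pos_of_pos (show 0 < (n : ℝ) / 2 by linarith)
  have := Real.pi_pos
  unfold normMoment
  positivity

/-- By rotation invariance x may be replaced by ‖x‖ e₀. The integrand then factors over coordinates,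
and each of the n - 1 other coordinates contributes √π. -/
lemma integral_abs_inner_rpow_mul_exp {n : ℕ} (hn : 1 ≤ n) {p : ℝ} (hp : 0 < p)
    (x : EuclideanSpace ℝ (Fin n)) :
    ∫ g : EuclideanSpace ℝ (Fin n), |inner ℝ x g| ^ p * Real.exp (-‖g‖ ^ 2) =
      linearMoment n p * ‖x‖ ^ p := by
  obtain ⟨m, rfl⟩ : ∃ m, n = m + 1 := ⟨n - 1, by omega⟩
  have h := integral_inner_norm_eq_of_norm_eq (fun s r => |s| ^ p * Real.exp (-r ^ 2))
    (x := x) (y := EuclideanSpace.single (0 : Fin (m + 1)) ‖x‖) (by simp)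
  rw [h, ← (EuclideanSpace.volume_preserving_symm_measurableEquiv_toLp
    (Fin (m + 1))).symm.integral_comp (MeasurableEquiv.measurableEmbedding _)]
  have h1 : ∀ y : Fin (m + 1) → ℝ, |inner ℝ (EuclideanSpace.single (0 : Fin (m + 1)) ‖x‖)
        ((MeasurableEquiv.toLp 2 (Fin (m + 1) → ℝ)).symm.symm y)| ^ p *
      Real.exp (-‖(MeasurableEquiv.toLp 2 (Fin (m + 1) → ℝ)).symm.symm y‖ ^ 2) =
      ‖x‖ ^ p * ∏ i, (Fin.cons (fun t : ℝ => |t| ^ p * Real.exp (-t ^ 2))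
        (fun _ t => Real.exp (-t ^ 2)) : Fin (m + 1) → ℝ → ℝ) i (y i) := by
    intro y
    rw [Fin.prod_univ_succ]
    simp only [Fin.cons_zero, Fin.cons_succ, EuclideanSpace.norm_sq_eq, ← Real.exp_sum,
      Fin.sum_univ_succ]
    simp only [EuclideanSpace.inner_single_left, MeasurableEquiv.symm_symm,
      MeasurableEquiv.coe_toLp, neg_add, Real.exp_add, Finset.sum_neg_distrib, Real.norm_eq_abs,
      sq_abs, conj_trivial, abs_mul, abs_norm]
    rw [Real.mul_rpow (norm_nonneg _) (abs_nonneg _)]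
    ring
  simp_rw [h1]
  rw [integral_const_mul, integral_fintype_prod_volume_eq_prod, Fin.prod_univ_succ]
  simp only [Fin.cons_zero, Fin.cons_succ]
  have h2 : ∫ t : ℝ, Real.exp (-t ^ 2) = √Real.pi := by
    simpa using integral_gaussian 1
  rw [integral_abs_rpow_mul_exp_neg_sq hp, h2]
  simp [linearMoment]
  ring

lemma integral_norm_rpow_mul_exp {n : ℕ} (hn : 1 ≤ n) {p : ℝ} (hp : 0 < p) :
    ∫ g : EuclideanSpace ℝ (Fin n), ‖g‖ ^ p * Real.exp (-‖g‖ ^ 2) = normMoment n p := by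
  have : Nonempty (Fin n) := ⟨⟨0, hn⟩⟩
  have hn' : (1 : ℝ) ≤ n := by exact_mod_cast hn
  have hG := Real.Gamma_pos_of_pos (show 0 < (n : ℝ) / 2 by linarith)
  have h := integral_fun_norm_addHaar (volume : Measure (EuclideanSpace ℝ (Fin n)))
    (fun r => r ^ p * Real.exp (-r ^ 2))
  have h1 : ∫ y in Set.Ioi (0 : ℝ), y ^ (n - 1) • (y ^ p * Real.exp (-y ^ 2)) =
      1 / 2 * Real.Gamma ((p + n) / 2) := by
    have h2 := integral_rpow_mul_exp_neg_rpow (p := 2) (q := n - 1 + p) (by norm_num)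
      (by linarith)
    simp only [Real.rpow_ofNat] at h2
    rw [show (n - 1 + p + 1 : ℝ) = p + n by ring] at h2
    rw [← h2]
    refine setIntegral_congr_fun measurableSet_Ioi fun y hy => ?_
    have hy : (0 : ℝ) < y := hy
    simp only [smul_eq_mul]
    rw [Real.rpow_add hy, ← mul_assoc, ← Real.rpow_natCast, Nat.cast_sub hn, Nat.cast_one]
  rw [h, finrank_euclideanSpace_fin, h1, Measure.real, EuclideanSpace.volume_ball]
  simp only [ENNReal.ofReal_one, one_pow, one_mul, Fintype.card_fin]
  rw [ENNReal.toReal_ofReal (by positivity), Real.Gamma_add_one (by positivity), normMoment,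
    nsmul_eq_mul, smul_eq_mul]
  field_simp

lemma integrable_norm_rpow_mul_exp {n : ℕ} (hn : 1 ≤ n) {p : ℝ} (hp : 0 < p) :
    Integrable fun g : EuclideanSpace ℝ (Fin n) => ‖g‖ ^ p * Real.exp (-‖g‖ ^ 2) := by
  -- The integral of a non-integrable function is 0 by convention, so a nonzero value proves
  -- integrability.
  refine Integrable.of_integral_ne_zero ?_
  rw [integral_norm_rpow_mul_exp hn hp]
  exact (normMoment_pos hn hp).ne'

lemma integrable_abs_inner_rpow_mul_exp {n : ℕ} (hn : 1 ≤ n) {p : ℝ} (hp : 0 < p)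
    (x : EuclideanSpace ℝ (Fin n)) : Integrable fun g : EuclideanSpace ℝ (Fin n) =>
      |inner ℝ x g| ^ p * Real.exp (-‖g‖ ^ 2) := by
  rcases eq_or_ne x 0 with rfl | hx
  · simp [Real.zero_rpow hp.ne']
  refine Integrable.of_integral_ne_zero ?_
  rw [integral_abs_inner_rpow_mul_exp hn hp]
  exact (mul_pos (linearMoment_pos n hp) (Real.rpow_pos_of_pos (norm_pos_iff.2 hx) _)).ne'

lemma normMoment_div_linearMoment {n : ℕ} (hn : 1 ≤ n) (α : ℝ) :
    normMoment n (2 * α) / linearMoment n (2 * α) =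
      Real.pi ^ (1 / 2 : ℝ) * Real.Gamma (α + n / 2) /
        (Real.Gamma (α + 1 / 2) * Real.Gamma (n / 2)) := by
  obtain ⟨m, rfl⟩ : ∃ m, n = m + 1 := ⟨n - 1, by omega⟩
  have hpi : 0 < √Real.pi := Real.sqrt_pos.2 Real.pi_pos
  rw [normMoment, linearMoment, ← Real.sqrt_eq_rpow, Nat.add_sub_cancel, pow_succ,
    show (2 * α + (m + 1 : ℕ)) / 2 = α + (m + 1 : ℕ) / 2 by ring,
    show (2 * α + 1) / 2 = α + 1 / 2 by ring]
  field_simp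

/-- Projection along g/‖g‖ sends the unit ball into [-1, 1]; rescaling costs ‖g‖^p. -/
lemma IsEnergyBound.sum_abs_inner_sub_le {V : Type*} [NormedAddCommGroup V]
    [InnerProductSpace ℝ V] {p m : ℝ} (hp : 0 < p) (hm : IsEnergyBound p (Set.Icc (-1 : ℝ) 1) m)
    {ι : Type} (s : Finset ι) (x : ι → V) (a : ι → ℝ) (hx : ∀ i, ‖x i‖ ≤ 1) (g : V) :
    ∑ i ∈ s, ∑ j ∈ s, a i * a j * |inner ℝ (x i - x j) g| ^ p ≤
      m * ‖g‖ ^ p * (∑ i ∈ s, a i) ^ 2 := by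
  rcases eq_or_ne g 0 with rfl | hg
  · simp [Real.zero_rpow hp.ne']
  have hg' : 0 < ‖g‖ := norm_pos_iff.2 hg
  have h := hm ι s (fun i => inner ℝ (x i) (‖g‖⁻¹ • g)) a fun i => by
    rw [Set.mem_Icc, ← abs_le]
    refine (abs_real_inner_le_norm _ _).trans ?_
    rw [norm_smul, norm_inv, norm_norm, inv_mul_cancel₀ hg'.ne', mul_one]
    exact hx i
  have h1 : ∀ i j, |inner ℝ (x i - x j) g| ^ p =
      ‖g‖ ^ p * dist (inner ℝ (x i) (‖g‖⁻¹ • g)) (inner ℝ (x j) (‖g‖⁻¹ • g)) ^ p := by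
    intro i j
    rw [← Real.mul_rpow hg'.le dist_nonneg, Real.dist_eq, ← inner_sub_left, inner_smul_right,
      abs_mul, abs_inv, abs_norm, mul_inv_cancel_left₀ hg'.ne']
  simp_rw [h1, mul_left_comm _ (‖g‖ ^ p), ← Finset.mul_sum]
  have := mul_le_mul_of_nonneg_left h (Real.rpow_nonneg hg'.le p)
  linarith

/-- An energy bound on the interval yields one on the Euclidean ball. -/
lemma IsEnergyBound.closedBall {p m : ℝ} (hp : 0 < p) {n : ℕ} (hn : 1 ≤ n)
    (hm : IsEnergyBound p (Set.Icc (-1 : ℝ) 1) m) :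
    IsEnergyBound p (Metric.closedBall (0 : EuclideanSpace ℝ (Fin n)) 1)
      (m * (normMoment n p / linearMoment n p)) := by
  intro ι s x a hx
  have hL := linearMoment_pos n hp
  have hI := fun i j => (integrable_abs_inner_rpow_mul_exp hn hp (x i - x j)).const_mul (a i * a j)
  have hI' : Integrable fun g : EuclideanSpace ℝ (Fin n) => ∑ i ∈ s, ∑ j ∈ s, a i * a j *
      (|inner ℝ (x i - x j) g| ^ p * Real.exp (-‖g‖ ^ 2)) :=
    integrable_finsetSum _ fun i _ => integrable_finsetSum _ fun j _ => hI i j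
  have h1 : ∫ g : EuclideanSpace ℝ (Fin n), ∑ i ∈ s, ∑ j ∈ s, a i * a j *
      (|inner ℝ (x i - x j) g| ^ p * Real.exp (-‖g‖ ^ 2)) =
      linearMoment n p * ∑ i ∈ s, ∑ j ∈ s, a i * a j * dist (x i) (x j) ^ p := by
    rw [integral_finsetSum _ fun i _ => integrable_finsetSum _ fun j _ => hI i j, Finset.mul_sum]
    refine Finset.sum_congr rfl fun i _ => ?_
    rw [integral_finsetSum _ fun j _ => hI i j, Finset.mul_sum]
    refine Finset.sum_congr rfl fun j _ => ?_
    rw [integral_const_mul, integral_abs_inner_rpow_mul_exp hn hp, dist_eq_norm]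
    ring
  have h2 : ∫ g : EuclideanSpace ℝ (Fin n), ∑ i ∈ s, ∑ j ∈ s, a i * a j *
      (|inner ℝ (x i - x j) g| ^ p * Real.exp (-‖g‖ ^ 2)) ≤
      ∫ g : EuclideanSpace ℝ (Fin n),
        m * (∑ i ∈ s, a i) ^ 2 * (‖g‖ ^ p * Real.exp (-‖g‖ ^ 2)) := by
    refine integral_mono hI' ((integrable_norm_rpow_mul_exp hn hp).const_mul _) fun g => ?_
    have := mul_le_mul_of_nonneg_right (hm.sum_abs_inner_sub_le hp s x a
      (fun i => by simpa using hx i) g) (Real.exp_pos (-‖g‖ ^ 2)).le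
    simp_rw [Finset.sum_mul, mul_assoc] at this ⊢
    linarith
  rw [h1, integral_const_mul, integral_norm_rpow_mul_exp hn hp] at h2
  have e : m * (normMoment n p / linearMoment n p) * (∑ i ∈ s, a i) ^ 2 =
      m * (∑ i ∈ s, a i) ^ 2 * normMoment n p / linearMoment n p := by ring
  rw [e, le_div_iff₀ hL]
  linarith

/-! ### Least energy bounds and dominated linear forms -/

lemma IsEnergyBound.sum_nonpos {p C : ℝ} {E : Type*} [Dist E] {K : Set E}
    (h : IsEnergyBound p K C) {ι : Type} (s : Finset ι) (x : ι → E) (a : ι → ℝ)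
    (hx : ∀ i, x i ∈ K) (ha : ∑ i ∈ s, a i = 0) :
    ∑ i ∈ s, ∑ j ∈ s, a i * a j * dist (x i) (x j) ^ p ≤ 0 := by
  simpa [ha] using h ι s x a hx

/-- The least energy bound on a set. -/
noncomputable def leastEnergyBound {E : Type*} [Dist E] (p : ℝ) (K : Set E) : ℝ :=
  sInf {C | IsEnergyBound p K C}

lemma IsEnergyBound.nonneg {p C : ℝ} (hp : 0 < p) {E : Type*} [PseudoMetricSpace E] {K : Set E}
    (hK : K.Nonempty) (h : IsEnergyBound p K C) : 0 ≤ C := by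
  obtain ⟨x, hx⟩ := hK
  simpa [Real.zero_rpow hp.ne'] using h Unit Finset.univ (fun _ => x) (fun _ => 1) fun _ => hx

lemma leastEnergyBound_le {p C : ℝ} (hp : 0 < p) {E : Type*} [PseudoMetricSpace E] {K : Set E}
    (hK : K.Nonempty) (h : IsEnergyBound p K C) : leastEnergyBound p K ≤ C :=
  csInf_le ⟨0, fun _ h' => IsEnergyBound.nonneg hp hK h'⟩ h

lemma IsEnergyBound.isEnergyBound_leastEnergyBound {p C : ℝ} {E : Type*}
    [PseudoMetricSpace E] {K : Set E} (h : IsEnergyBound p K C) :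
    IsEnergyBound p K (leastEnergyBound p K) := by
  intro ι s x a hx
  -- At mass zero the inequality no longer involves the constant, so any bound settles it; otherwise
  -- division by the squared mass is possible.
  rcases eq_or_ne (∑ i ∈ s, a i) 0 with ha | ha
  · rw [ha]
    simpa using h.sum_nonpos s x a hx ha
  · have ha' : 0 < (∑ i ∈ s, a i) ^ 2 := by positivity
    rw [← div_le_iff₀ ha']
    exact le_csInf ⟨C, h⟩ fun D hD => (div_le_iff₀ ha').2 (hD ι s x a hx)

/-- A linear form dominated by the norm of a linear map factors through it by a vector. -/
lemma exists_inner_eq_of_abs_le {V H : Type*} [AddCommGroup V] [Module ℝ V]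
    [NormedAddCommGroup H] [InnerProductSpace ℝ H] [CompleteSpace H] (L : V →ₗ[ℝ] H)
    (M : V →ₗ[ℝ] ℝ) {c : ℝ} (hc : 0 ≤ c) (h : ∀ v, |M v| ≤ c * ‖L v‖) :
    ∃ w : H, ‖w‖ ≤ c ∧ ∀ v, inner ℝ w (L v) = M v := by
  -- Domination makes M vanish on the kernel of L, so M factors through L; the factor is bounded by
  -- c on the range, and Hahn–Banach and Riesz apply.
  have hM : M ∈ (LinearMap.ker L).dualAnnihilator := by
    rw [Submodule.mem_dualAnnihilator]
    intro v hv
    have := h v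
    rw [LinearMap.mem_ker.1 hv, norm_zero, mul_zero] at this
    exact abs_nonpos_iff.1 this
  rw [← LinearMap.range_dualMap_eq_dualAnnihilator_ker] at hM
  obtain ⟨φ, rfl⟩ := hM
  let ψ : StrongDual ℝ (LinearMap.range L) := (φ.domRestrict (LinearMap.range L)).mkContinuous c
    (by rintro ⟨_, v, rfl⟩; exact h v)
  obtain ⟨ψ', hψ', hnorm⟩ := exists_extension_norm_eq (LinearMap.range L) ψ
  refine ⟨(InnerProductSpace.toDual ℝ H).symm ψ', ?_, fun v => ?_⟩
  · rw [LinearIsometryEquiv.norm_map, hnorm]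
    exact LinearMap.mkContinuous_norm_le _ hc _
  · rw [InnerProductSpace.toDual_symm_apply]
    exact hψ' ⟨L v, v, rfl⟩

lemma norm_sum_smul_sq {ι H : Type*} [NormedAddCommGroup H] [InnerProductSpace ℝ H]
    (s : Finset ι) (a : ι → ℝ) (u : ι → H) {C : ℝ} {k : ι → ι → ℝ}
    (h : ∀ i j, inner ℝ (u i) (u j) = C - k i j) :
    ‖∑ i ∈ s, a i • u i‖ ^ 2 =
      C * (∑ i ∈ s, a i) ^ 2 - ∑ i ∈ s, ∑ j ∈ s, a i * a j * k i j := by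
  have hA : C * (∑ i ∈ s, a i) ^ 2 = ∑ i ∈ s, ∑ j ∈ s, C * (a i * a j) := by
    rw [pow_two, Finset.sum_mul_sum, Finset.mul_sum]
    simp_rw [Finset.mul_sum]
  rw [← real_inner_self_eq_norm_sq, sum_inner, hA]
  simp_rw [inner_sum, inner_smul_left, inner_smul_right, h, ← Finset.sum_sub_distrib]
  refine Finset.sum_congr rfl fun i _ => Finset.sum_congr rfl fun j _ => ?_
  simp
  ring

/-! ### Energies of radial densities -/

section Integral

variable {E H : Type*} [TopologicalSpace E] [MeasurableSpace E] [OpensMeasurableSpace E]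
  [NormedAddCommGroup H] [InnerProductSpace ℝ H] [CompleteSpace H]
  {μ : Measure E} [IsFiniteMeasureOnCompacts μ]

/-- The norm of a weighted average of a feature map in terms of its kernel. -/
lemma norm_integral_smul_sq {F : E → ℝ} (hF : Continuous F)
    (hF' : HasCompactSupport F) {J : E → H} (hJ : Continuous J) {C : ℝ} {k : E → E → ℝ}
    (hk : ∀ x y, F x ≠ 0 → F y ≠ 0 → inner ℝ (J x) (J y) = C - k x y) :
    ‖∫ x, F x • J x ∂μ‖ ^ 2 =
      C * (∫ x, F x ∂μ) ^ 2 - ∫ x, ∫ y, F x * F y * k x y ∂μ ∂μ := by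
  have hI : Integrable (fun x => F x • J x) μ :=
    (hF.smul hJ).integrable_of_hasCompactSupport hF'.smul_right
  have hIF : Integrable F μ := hF.integrable_of_hasCompactSupport hF'
  set v := ∫ x, F x • J x ∂μ
  have h1 : ∀ x, ∫ y, F x * F y * k x y ∂μ = C * (∫ y, F y ∂μ) * F x - inner ℝ v (F x • J x) := by
    intro x
    rcases eq_or_ne (F x) 0 with hx | hx
    · simp [hx]
    have h2 : ∀ y, F x * F y * k x y = C * F x * F y - inner ℝ (F x • J x) (F y • J y) := by
      intro y
      rcases eq_or_ne (F y) 0 with hy | hy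
      · simp [hy]
      rw [inner_smul_left, inner_smul_right, hk x y hx hy]
      simp
      ring
    simp_rw [h2]
    rw [integral_sub (hIF.const_mul _) (hI.const_inner _), integral_const_mul, integral_inner hI,
      real_inner_comm]
    ring
  simp_rw [h1]
  rw [integral_sub (hIF.const_mul _) (hI.const_inner _), integral_const_mul, integral_inner hI,
    real_inner_self_eq_norm_sq]
  ring

end Integral

lemma continuous_abs_rpow_comp {E : Type*} [TopologicalSpace E] {p : ℝ} (hp : 0 < p) {f : E → ℝ}
    (hf : Continuous f) : Continuous fun x => |f x| ^ p :=
  hf.abs.rpow_const fun _ => .inr hp.le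

section Radial

variable {n : ℕ} {η : ℝ → ℝ}

lemma hasCompactSupport_comp_norm {V : Type*} [NormedAddCommGroup V] [ProperSpace V]
    (hη' : ∀ r, 1 ≤ r → η r = 0) : HasCompactSupport fun x : V => η ‖x‖ := by
  refine HasCompactSupport.intro (isCompact_closedBall (0 : V) 1) fun x hx => hη' _ ?_
  simpa using (le_of_lt (by simpa using hx : 1 < ‖x‖))

/-- The energy of a radial function along a line only depends on the length of the direction. -/
lemma integral_integral_abs_inner_rpow_eq (p : ℝ)
    {e : EuclideanSpace ℝ (Fin n)} (he : ‖e‖ = 1) (g : EuclideanSpace ℝ (Fin n)) :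
    ∫ x : EuclideanSpace ℝ (Fin n), ∫ y : EuclideanSpace ℝ (Fin n),
        η ‖x‖ * η ‖y‖ * |inner ℝ g (x - y)| ^ p =
      ‖g‖ ^ p * ∫ x : EuclideanSpace ℝ (Fin n), ∫ y : EuclideanSpace ℝ (Fin n),
        η ‖x‖ * η ‖y‖ * |inner ℝ e (x - y)| ^ p := by
  have h : ‖g‖ = ‖‖g‖ • e‖ := by rw [norm_smul, he, norm_norm, mul_one]
  set R := Submodule.reflection (ℝ ∙ (g - ‖g‖ • e))ᗮ
  have hR : R g = ‖g‖ • e := Submodule.reflection_sub h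
  have hx : ∀ x y, |inner ℝ g (x - y)| ^ p = ‖g‖ ^ p * |inner ℝ e (R x - R y)| ^ p := by
    intro x y
    rw [← R.inner_map_map, hR, inner_smul_left, map_sub, abs_mul,
      Real.mul_rpow (abs_nonneg _) (abs_nonneg _)]
    simp
  have hm := R.measurePreserving.integral_comp R.toHomeomorph.measurableEmbedding (G := ℝ)
  rw [← integral_const_mul]
  conv_rhs => rw [← hm]
  refine integral_congr_ae (.of_forall fun x => ?_)
  simp only
  rw [← integral_const_mul]
  conv_rhs => rw [← hm]
  refine integral_congr_ae (.of_forall fun y => ?_)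
  simp only [LinearIsometryEquiv.norm_map, hx]
  ring

/-- The energy of a radial function is proportional to the energy of its marginals. -/
lemma linearMoment_mul_integral_integral_eq (hn : 1 ≤ n) {p : ℝ} (hp : 0 < p) (hη : Continuous η)
    (hη' : ∀ r, 1 ≤ r → η r = 0) {e : EuclideanSpace ℝ (Fin n)} (he : ‖e‖ = 1) :
    linearMoment n p * ∫ x : EuclideanSpace ℝ (Fin n), ∫ y : EuclideanSpace ℝ (Fin n),
        η ‖x‖ * η ‖y‖ * dist x y ^ p =
      normMoment n p * ∫ x : EuclideanSpace ℝ (Fin n), ∫ y : EuclideanSpace ℝ (Fin n),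
        η ‖x‖ * η ‖y‖ * |inner ℝ e (x - y)| ^ p := by
  let F : EuclideanSpace ℝ (Fin n) × EuclideanSpace ℝ (Fin n) → ℝ := fun z => η ‖z.1‖ * η ‖z.2‖
  have hFc : Continuous F := by fun_prop
  have hF0 : ∀ z, F z ≠ 0 → ‖z.1‖ ≤ 1 ∧ ‖z.2‖ ≤ 1 := by
    intro z hz
    constructor
    · by_contra! h
      exact hz (by simp [F, hη' _ h.le])
    · by_contra! h
      exact hz (by simp [F, hη' _ h.le])
  have hFs : HasCompactSupport F := by
    refine HasCompactSupport.intro ((isCompact_closedBall (0 : EuclideanSpace ℝ (Fin n)) 1).prod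
      (isCompact_closedBall (0 : EuclideanSpace ℝ (Fin n)) 1)) fun z hz => ?_
    by_contra h
    exact hz (by simpa using hF0 z h)
  have hprod : ∀ k : EuclideanSpace ℝ (Fin n) → EuclideanSpace ℝ (Fin n) → ℝ,
      Continuous (Function.uncurry k) →
      ∫ x : EuclideanSpace ℝ (Fin n), ∫ y : EuclideanSpace ℝ (Fin n), η ‖x‖ * η ‖y‖ * k x y =
        ∫ z, F z * k z.1 z.2 := by
    intro k hk
    have hk : Continuous fun z : EuclideanSpace ℝ (Fin n) × EuclideanSpace ℝ (Fin n) =>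
      k z.1 z.2 := hk
    exact (integral_prod (fun z => F z * k z.1 z.2)
      ((hFc.mul hk).integrable_of_hasCompactSupport hFs.mul_right)).symm
  have hsub : ∀ g : EuclideanSpace ℝ (Fin n), Continuous
      (Function.uncurry fun x y : EuclideanSpace ℝ (Fin n) => |inner ℝ g (x - y)| ^ p) :=
    fun g => continuous_abs_rpow_comp hp (by fun_prop)
  -- Fubini is applied to this integrand: integrating g first yields the distance kernel,
  -- integrating z first yields the energy along e. On the support of F the points are at distance
  -- at most 2, whence the factor 2^p.
  have hint : Integrable (Function.uncurry fun (g : EuclideanSpace ℝ (Fin n))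
      (z : EuclideanSpace ℝ (Fin n) × EuclideanSpace ℝ (Fin n)) =>
        F z * (|inner ℝ g (z.1 - z.2)| ^ p * Real.exp (-‖g‖ ^ 2))) (volume.prod volume) := by
    refine ((integrable_norm_rpow_mul_exp hn hp).mul_prod
      ((hFc.integrable_of_hasCompactSupport hFs).abs.const_mul (2 ^ p))).mono' ?_
      (.of_forall fun ⟨g, z⟩ => ?_)
    · apply Continuous.aestronglyMeasurable
      have : Continuous fun q : EuclideanSpace ℝ (Fin n) ×
          EuclideanSpace ℝ (Fin n) × EuclideanSpace ℝ (Fin n) =>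
          |inner ℝ q.1 (q.2.1 - q.2.2)| ^ p := continuous_abs_rpow_comp hp (by fun_prop)
      simp only [Function.uncurry_def]
      fun_prop
    · simp only [Function.uncurry, norm_mul, Real.norm_eq_abs, Real.abs_exp]
      rcases eq_or_ne (F z) 0 with hz | hz
      · simp [hz]
      obtain ⟨h1, h2⟩ := hF0 z hz
      have h3 : |inner ℝ g (z.1 - z.2)| ^ p ≤ ‖g‖ ^ p * 2 ^ p := by
        rw [← Real.mul_rpow (norm_nonneg _) (by norm_num)]
        refine Real.rpow_le_rpow (abs_nonneg _) ((abs_real_inner_le_norm _ _).trans ?_) hp.le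
        gcongr
        exact (norm_sub_le _ _).trans (by linarith)
      rw [abs_of_nonneg (Real.rpow_nonneg (abs_nonneg _) p)]
      calc |F z| * (|inner ℝ g (z.1 - z.2)| ^ p * Real.exp (-‖g‖ ^ 2))
          ≤ |F z| * (‖g‖ ^ p * 2 ^ p * Real.exp (-‖g‖ ^ 2)) := by gcongr
        _ = _ := by ring
  have hswap := integral_integral_swap hint
  have hl : ∀ g : EuclideanSpace ℝ (Fin n),
      ∫ z, F z * (|inner ℝ g (z.1 - z.2)| ^ p * Real.exp (-‖g‖ ^ 2)) =
      (∫ z, F z * |inner ℝ e (z.1 - z.2)| ^ p) * (‖g‖ ^ p * Real.exp (-‖g‖ ^ 2)) := by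
    intro g
    have := integral_integral_abs_inner_rpow_eq (η := η) p he g
    rw [hprod _ (hsub g), hprod _ (hsub e)] at this
    simp_rw [← mul_assoc]
    rw [integral_mul_const, this]
    ring
  have hr : ∀ z : EuclideanSpace ℝ (Fin n) × EuclideanSpace ℝ (Fin n),
      ∫ g : EuclideanSpace ℝ (Fin n),
        F z * (|inner ℝ g (z.1 - z.2)| ^ p * Real.exp (-‖g‖ ^ 2)) =
      linearMoment n p * (F z * dist z.1 z.2 ^ p) := by
    intro z
    simp_rw [real_inner_comm (z.1 - z.2)]
    rw [integral_const_mul, integral_abs_inner_rpow_mul_exp hn hp, dist_eq_norm]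
    ring
  simp_rw [hl, hr] at hswap
  rw [integral_const_mul, integral_const_mul, integral_norm_rpow_mul_exp hn hp] at hswap
  rw [hprod _ (hsub e), hprod (fun x y => dist x y ^ p)
    (continuous_dist.rpow_const fun _ => .inr hp.le), ← hswap]
  ring

end Radial

/-! ### Marginals of radial densities and their completeness among even functions -/

lemma max_one_sub_sq_eq_zero {r : ℝ} (hr : 1 ≤ |r|) : max 0 (1 - r ^ 2) = 0 := by
  rw [max_eq_left]
  nlinarith [sq_abs r]

lemma hasCompactSupport_of_forall_one_le {f : ℝ → ℝ} (hf : ∀ t, 1 ≤ |t| → f t = 0) :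
    HasCompactSupport f :=
  HasCompactSupport.intro (isCompact_closedBall (0 : ℝ) 1) fun t ht => hf t (by
    simpa using (le_of_lt (by simpa using ht : 1 < |t|)))

/-- An even continuous function on `[-1, 1]` that is orthogonal to all polynomials in `1 - t²`
vanishes. -/
lemma eq_zero_of_integral_mul_pow_eq_zero {W ψ : ℝ → ℝ} (hW : Continuous W)
    (hW₀ : ∀ t, 1 ≤ |t| → W t = 0) (hW₁ : ∀ t, |t| < 1 → 0 < W t) (hψ : Continuous ψ)
    (hψ' : ∀ t, ψ (-t) = ψ t)
    (h : ∀ k : ℕ, ∫ t, W t * max 0 (1 - t ^ 2) ^ k * ψ t = 0) {t : ℝ} (ht : |t| ≤ 1) :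
    ψ t = 0 := by
  have hWnn : ∀ t, 0 ≤ W t := fun t => by
    rcases lt_or_ge |t| 1 with h | h
    · exact (hW₁ t h).le
    · rw [hW₀ t h]
  have hWs := hasCompactSupport_of_forall_one_le hW₀
  have hpoly : ∀ q : Polynomial ℝ, ∫ t, W t * q.eval (max 0 (1 - t ^ 2)) * ψ t = 0 := by
    intro q
    have e : ∀ t, W t * q.eval (max 0 (1 - t ^ 2)) * ψ t =
        ∑ k ∈ Finset.range (q.natDegree + 1),
          q.coeff k * (W t * max 0 (1 - t ^ 2) ^ k * ψ t) := by
      intro t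
      rw [Polynomial.eval_eq_sum_range, Finset.mul_sum, Finset.sum_mul]
      exact Finset.sum_congr rfl fun k _ => by ring
    simp_rw [e]
    rw [integral_finsetSum]
    · simp_rw [integral_const_mul, h, mul_zero, Finset.sum_const_zero]
    · intro k _
      refine Integrable.const_mul ?_ _
      have hc : Continuous fun t => W t * max 0 (1 - t ^ 2) ^ k * ψ t := by fun_prop
      exact hc.integrable_of_hasCompactSupport hWs.mul_right.mul_right
  have hIψ : Integrable fun t => W t * |ψ t| :=
    (hW.mul hψ.abs).integrable_of_hasCompactSupport hWs.mul_right
  have hc : Continuous fun t => W t * ψ t ^ 2 := by fun_prop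
  have hcs : HasCompactSupport fun t => W t * ψ t ^ 2 := hWs.mul_right
  have hI : Integrable fun t => W t * ψ t ^ 2 := hc.integrable_of_hasCompactSupport hcs
  have hle : ∀ ε > 0, ∫ t, W t * ψ t ^ 2 ≤ ε * ∫ t, W t * |ψ t| := by
    intro ε hε
    -- An even ψ is a continuous function of s = 1 - t² on [0, 1], to which Weierstrass applies.
    obtain ⟨q, hq⟩ := exists_polynomial_near_of_continuousOn 0 1 (fun s => ψ (√(1 - s)))
      (by fun_prop) ε hε
    have hqc : Continuous fun t => W t * q.eval (max 0 (1 - t ^ 2)) * ψ t := by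
      have := q.continuous
      fun_prop
    have hqI := hqc.integrable_of_hasCompactSupport (μ := volume) hWs.mul_right.mul_right
    have e : ∫ t, W t * ψ t ^ 2 =
        ∫ t, (W t * ψ t ^ 2 - W t * q.eval (max 0 (1 - t ^ 2)) * ψ t) := by
      rw [integral_sub hI hqI, hpoly q, sub_zero]
    rw [e, ← integral_const_mul]
    refine integral_mono (hI.sub hqI) (hIψ.const_mul _) fun t => ?_
    simp only
    rcases le_or_gt 1 |t| with ht | ht
    · simp [hW₀ t ht]
    have ht2 : t ^ 2 ≤ 1 := by nlinarith [sq_abs t, abs_nonneg t]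
    rw [max_eq_right (by linarith)]
    have h1 := hq (1 - t ^ 2) ⟨by linarith, by nlinarith⟩
    have h2 : ψ (√(1 - (1 - t ^ 2))) = ψ t := by
      rw [sub_sub_cancel, Real.sqrt_sq_eq_abs]
      rcases abs_choice t with h | h <;> rw [h]
      exact hψ' t
    rw [h2] at h1
    calc W t * ψ t ^ 2 - W t * q.eval (1 - t ^ 2) * ψ t
        = W t * ((ψ t - q.eval (1 - t ^ 2)) * ψ t) := by ring
      _ ≤ W t * |(ψ t - q.eval (1 - t ^ 2)) * ψ t| :=
          mul_le_mul_of_nonneg_left (le_abs_self _) (hWnn t)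
      _ ≤ W t * (ε * |ψ t|) := by
          rw [abs_mul, abs_sub_comm]
          have := hWnn t
          gcongr
      _ = _ := by ring
  have h0 : ∫ t, W t * ψ t ^ 2 ≤ 0 := by
    set B := ∫ t, W t * |ψ t|
    have hB : 0 ≤ B := integral_nonneg fun t => mul_nonneg (hWnn t) (abs_nonneg _)
    refine le_of_forall_pos_le_add fun δ hδ => ?_
    refine (hle (δ / (B + 1)) (by positivity)).trans ?_
    rw [div_mul_eq_mul_div, div_le_iff₀ (by positivity)]
    nlinarith
  -- The weight is positive only on the open interval; the endpoints follow by continuity.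
  have hz : ∀ t ∈ Set.Ioo (-1 : ℝ) 1, ψ t = 0 := by
    intro t ht
    by_contra hne
    have hWt := hW₁ t (abs_lt.2 ht)
    have := hc.integral_pos_of_hasCompactSupport_nonneg_nonzero (μ := volume) hcs
      (fun t => mul_nonneg (hWnn t) (sq_nonneg _)) (x := t) (by positivity)
    linarith
  have hcl : closure (Set.Ioo (-1 : ℝ) 1) = Set.Icc (-1) 1 := closure_Ioo (by norm_num)
  have : Set.EqOn ψ (fun _ => 0) (closure (Set.Ioo (-1 : ℝ) 1)) :=
    Set.EqOn.closure hz hψ continuous_const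
  exact this (by rw [hcl]; exact abs_le.1 ht)

/-- The slice at height t is a ball of radius √(1 - t²), rescaled to the unit ball. The exponent is
k + 1 because a zeroth power would not vanish outside the ball. -/
lemma integral_max_sub_sum_sq_pow (m k : ℕ) (t : ℝ) :
    ∫ y : Fin m → ℝ, max 0 (1 - (t ^ 2 + ∑ i, y i ^ 2)) ^ (k + 1) =
      √(max 0 (1 - t ^ 2)) ^ m * max 0 (1 - t ^ 2) ^ (k + 1) *
        ∫ y : Fin m → ℝ, max 0 (1 - ∑ i, y i ^ 2) ^ (k + 1) := by
  rcases le_or_gt (1 - t ^ 2) 0 with h | h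
  · have h1 : ∀ y : Fin m → ℝ, max 0 (1 - (t ^ 2 + ∑ i, y i ^ 2)) = 0 := fun y => by
      have : 0 ≤ ∑ i, y i ^ 2 := Finset.sum_nonneg fun i _ => sq_nonneg _
      exact max_eq_left (by linarith)
    simp [h1, max_eq_left h]
  · rw [max_eq_right h.le]
    have hs : 0 < √(1 - t ^ 2) := Real.sqrt_pos.2 h
    have h1 := Measure.integral_comp_smul (volume : Measure (Fin m → ℝ))
      (fun y : Fin m → ℝ => max 0 (1 - (t ^ 2 + ∑ i, y i ^ 2)) ^ (k + 1)) (√(1 - t ^ 2))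
    have h2 : ∀ y : Fin m → ℝ,
        max 0 (1 - (t ^ 2 + ∑ i, (√(1 - t ^ 2) • y) i ^ 2)) ^ (k + 1) =
          (1 - t ^ 2) ^ (k + 1) * max 0 (1 - ∑ i, y i ^ 2) ^ (k + 1) := by
      intro y
      rw [← mul_pow, mul_max_of_nonneg _ _ h.le, mul_zero]
      simp only [Pi.smul_apply, smul_eq_mul, mul_pow, Real.sq_sqrt h.le, ← Finset.mul_sum]
      congr 2
      ring
    simp_rw [h2] at h1
    rw [integral_const_mul] at h1
    rw [Module.finrank_fin_fun, abs_of_pos (by positivity), smul_eq_mul] at h1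
    rw [mul_assoc, h1, mul_inv_cancel_left₀ (by positivity)]

lemma integral_max_one_sub_sum_sq_pow_pos (m k : ℕ) :
    0 < ∫ y : Fin m → ℝ, max 0 (1 - ∑ i, y i ^ 2) ^ (k + 1) := by
  have hc : Continuous fun y : Fin m → ℝ => max 0 (1 - ∑ i, y i ^ 2) ^ (k + 1) := by fun_prop
  refine hc.integral_pos_of_hasCompactSupport_nonneg_nonzero (μ := volume) ?_
    (fun y => by positivity) (x := 0) (by simp)
  refine HasCompactSupport.intro (isCompact_closedBall (0 : Fin m → ℝ) 1) fun y hy => ?_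
  have : 1 < ‖y‖ := by simpa using hy
  obtain ⟨i, hi⟩ : ∃ i, 1 < |y i| := by
    by_contra! h
    exact absurd ((pi_norm_le_iff_of_nonneg zero_le_one).2 h) (not_le.2 this)
  have h1 : y i ^ 2 ≤ ∑ i, y i ^ 2 :=
    Finset.single_le_sum (f := fun i => y i ^ 2) (fun i _ => sq_nonneg _) (Finset.mem_univ i)
  rw [max_eq_left, zero_pow (by omega)]
  nlinarith [sq_abs (y i)]

/-- The one-dimensional marginals of the densities `(1 - ‖x‖²)^(k + 1)` on the ball. -/
lemma integral_max_one_sub_norm_sq_pow_mul (m k : ℕ) {ψ : ℝ → ℝ} (hψ : Continuous ψ) :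
    ∫ x : EuclideanSpace ℝ (Fin (m + 1)), max 0 (1 - ‖x‖ ^ 2) ^ (k + 1) * ψ (x 0) =
      (∫ y : Fin m → ℝ, max 0 (1 - ∑ i, y i ^ 2) ^ (k + 1)) *
        ∫ t : ℝ, √(max 0 (1 - t ^ 2)) ^ m * max 0 (1 - t ^ 2) ^ (k + 1) * ψ t := by
  let f : EuclideanSpace ℝ (Fin (m + 1)) → ℝ := fun x => max 0 (1 - ‖x‖ ^ 2) ^ (k + 1) * ψ (x 0)
  have hfc : Continuous f := by fun_prop
  have hfs : HasCompactSupport f := by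
    refine HasCompactSupport.mul_right ?_
    exact hasCompactSupport_comp_norm (η := fun r => max 0 (1 - r ^ 2) ^ (k + 1))
      fun r hr => by rw [max_one_sub_sq_eq_zero (hr.trans (le_abs_self r)), zero_pow (by omega)]
  have e1 := (EuclideanSpace.volume_preserving_symm_measurableEquiv_toLp (Fin (m + 1))).symm
  have e2 := (volume_preserving_piFinSuccAbove (fun _ : Fin (m + 1) => ℝ) 0).symm
  have e := e1.comp e2
  have hemb := (MeasurableEquiv.measurableEmbedding
    ((MeasurableEquiv.toLp 2 (Fin (m + 1) → ℝ)).symm.symm)).comp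
    (MeasurableEquiv.measurableEmbedding
      (MeasurableEquiv.piFinSuccAbove (fun _ : Fin (m + 1) => ℝ) 0).symm)
  have hval : ∀ z : ℝ × (Fin m → ℝ), f ((⇑(MeasurableEquiv.toLp 2 (Fin (m + 1) → ℝ)).symm.symm ∘
      ⇑(MeasurableEquiv.piFinSuccAbove (fun _ : Fin (m + 1) => ℝ) 0).symm) z) =
      max 0 (1 - (z.1 ^ 2 + ∑ i, z.2 i ^ 2)) ^ (k + 1) * ψ z.1 := by
    rintro ⟨t, y⟩
    simp [f, EuclideanSpace.norm_sq_eq, Fin.sum_univ_succ]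
  have hI := (e.integrable_comp_emb hemb).2 (hfc.integrable_of_hasCompactSupport hfs)
  have h := e.integral_comp hemb f
  rw [Function.comp_def] at hI
  simp_rw [hval] at h hI
  change ∫ x, f x = _
  rw [← h, Measure.volume_eq_prod, integral_prod _ hI, ← integral_const_mul]
  refine integral_congr_ae (.of_forall fun t => ?_)
  simp only
  rw [integral_mul_const, integral_max_sub_sum_sq_pow]
  ring

/-! ### Duality: from the ball to the interval -/

/-- Continuous radial profiles supported in the unit ball. -/
def radialProfile : Submodule ℝ C(ℝ, ℝ) where
  carrier := {f | ∀ r, 1 ≤ r → f r = 0}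
  add_mem' hf hg r hr := by simp [hf r hr, hg r hr]
  zero_mem' r _ := rfl
  smul_mem' c f hf r hr := by simp [hf r hr]

lemma integrable_radialProfile_smul {V H : Type*} [NormedAddCommGroup V] [ProperSpace V]
    [MeasurableSpace V] [BorelSpace V] [NormedAddCommGroup H] [NormedSpace ℝ H]
    (μ : Measure V) [IsFiniteMeasureOnCompacts μ] (f : radialProfile) {J : V → H}
    (hJ : Continuous J) : Integrable (fun x => f.1 ‖x‖ • J x) μ :=
  ((f.1.continuous.comp continuous_norm).smul hJ).integrable_of_hasCompactSupport
    (hasCompactSupport_comp_norm f.2).smul_right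

/-- The integral of a feature map against a radial profile, as a linear map in the profile. -/
noncomputable def radialIntegral {V H : Type*} [NormedAddCommGroup V] [ProperSpace V]
    [MeasurableSpace V] [BorelSpace V] [NormedAddCommGroup H] [NormedSpace ℝ H]
    (μ : Measure V) [IsFiniteMeasureOnCompacts μ] (J : V → H) (hJ : Continuous J) :
    radialProfile →ₗ[ℝ] H where
  toFun f := ∫ x, f.1 ‖x‖ • J x ∂μ
  map_add' f g := by
    rw [← integral_add (integrable_radialProfile_smul μ f hJ)
      (integrable_radialProfile_smul μ g hJ)]
    simp [add_smul]
  map_smul' c f := by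
    rw [RingHom.id_apply, ← integral_smul]
    simp [mul_smul]

lemma radialProfile_ne_zero {f : radialProfile} {r : ℝ} (h : f.1 r ≠ 0) : r ≤ 1 := by
  by_contra! h'
  exact h (f.2 r h'.le)

/-- The retraction of a normed space onto its unit ball is continuous and fixes the ball. -/
lemma exists_continuous_retraction_closedBall (V : Type*) [NormedAddCommGroup V]
    [NormedSpace ℝ V] : ∃ ρ : V → Metric.closedBall (0 : V) 1, Continuous ρ ∧
      ∀ x, ‖x‖ ≤ 1 → (ρ x : V) = x := by
  have hpos : ∀ x : V, 0 < max 1 ‖x‖ := fun x => lt_max_of_lt_left one_pos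
  refine ⟨fun x => ⟨(max 1 ‖x‖)⁻¹ • x, ?_⟩, ?_, fun x hx => ?_⟩
  · rw [mem_closedBall_zero_iff, norm_smul, norm_inv, Real.norm_of_nonneg (hpos x).le,
      inv_mul_le_iff₀ (hpos x), mul_one]
    exact le_max_right _ _
  · refine Continuous.subtype_mk ?_ _
    exact ((continuous_const.max continuous_norm).inv₀ fun x => (hpos x).ne').smul continuous_id
  · simp [max_eq_left hx]

/-- The radial profiles `(1 - r²)^(k + 1)`, whose marginals are explicit. -/
noncomputable def powerProfile (k : ℕ) : radialProfile :=
  ⟨⟨fun r => max 0 (1 - r ^ 2) ^ (k + 1), by fun_prop⟩, fun r hr => by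
    change max 0 (1 - r ^ 2) ^ (k + 1) = 0
    rw [max_one_sub_sq_eq_zero (hr.trans (le_abs_self r)), zero_pow (by omega)]⟩

lemma powerProfile_apply (k : ℕ) (r : ℝ) :
    (powerProfile k).1 r = max 0 (1 - r ^ 2) ^ (k + 1) := rfl

/-- The energy bound for radial densities in terms of the ball and of the interval. -/
lemma sub_mul_sq_le_norm_radialIntegral_sq {H : Type*} [NormedAddCommGroup H]
    [InnerProductSpace ℝ H] [CompleteSpace H] {p m C : ℝ} (hp : 0 < p) {d : ℕ}
    (hC : IsEnergyBound p (Metric.closedBall (0 : EuclideanSpace ℝ (Fin (d + 1))) 1) C)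
    {Φ : ℝ → H} (hΦ : Continuous Φ)
    (hin : ∀ s t, |s| ≤ 1 → |t| ≤ 1 → inner ℝ (Φ s) (Φ t) = m - |s - t| ^ p)
    (f : radialProfile) :
    (m - linearMoment (d + 1) p / normMoment (d + 1) p * C) *
        (∫ x : EuclideanSpace ℝ (Fin (d + 1)), f.1 ‖x‖) ^ 2 ≤
      ‖∫ x : EuclideanSpace ℝ (Fin (d + 1)), f.1 ‖x‖ • Φ (x 0)‖ ^ 2 := by
  obtain ⟨J₀, hJ₀, hJin⟩ := hC.exists_feature hp
  -- The retraction extends the feature map to the whole space; its values off the ball are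
  -- multiplied by zero.
  obtain ⟨ρ, hρ, hρid⟩ := exists_continuous_retraction_closedBall (EuclideanSpace ℝ (Fin (d + 1)))
  have hfc : Continuous fun x : EuclideanSpace ℝ (Fin (d + 1)) => f.1 ‖x‖ :=
    f.1.continuous.comp continuous_norm
  have hfs : HasCompactSupport fun x : EuclideanSpace ℝ (Fin (d + 1)) => f.1 ‖x‖ :=
    hasCompactSupport_comp_norm f.2
  have h1 := norm_integral_smul_sq (μ := volume) hfc hfs (hJ₀.comp hρ) (C := C)
    (k := fun x y => dist x y ^ p) fun x y hx hy => by
      rw [Function.comp, Function.comp, hJin, Subtype.dist_eq, hρid x (radialProfile_ne_zero hx),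
        hρid y (radialProfile_ne_zero hy)]
  have hcoord : ∀ x : EuclideanSpace ℝ (Fin (d + 1)), ‖x‖ ≤ 1 → |x 0| ≤ 1 := fun x hx =>
    (PiLp.norm_apply_le x 0).trans hx
  have h2 := norm_integral_smul_sq (μ := volume) hfc hfs
    (J := fun x : EuclideanSpace ℝ (Fin (d + 1)) => Φ (x 0)) (hΦ.comp (by fun_prop)) (C := m)
    (k := fun x y => |inner ℝ (EuclideanSpace.single (0 : Fin (d + 1)) (1 : ℝ)) (x - y)| ^ p)
    fun x y hx hy => by
      rw [hin _ _ (hcoord x (radialProfile_ne_zero hx)) (hcoord y (radialProfile_ne_zero hy))]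
      simp [EuclideanSpace.inner_single_left]
  have h3 := linearMoment_mul_integral_integral_eq (n := d + 1) (by omega) hp f.1.continuous f.2
    (e := EuclideanSpace.single (0 : Fin (d + 1)) (1 : ℝ)) (by simp)
  have hL := linearMoment_pos (d + 1) hp
  have hN := normMoment_pos (n := d + 1) (by omega) hp
  rw [h2]
  -- A squared norm is nonnegative, which bounds the energy of the density f on the ball by C (∫
  -- f)²; scaling by L/N turns this into a bound on the energy along the first coordinate.
  have h4 := sq_nonneg ‖∫ x : EuclideanSpace ℝ (Fin (d + 1)), f.1 ‖x‖ • (J₀ ∘ ρ) x‖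
  rw [h1] at h4
  have h5 : (0 : ℝ) ≤ linearMoment (d + 1) p / normMoment (d + 1) p := by positivity
  have h6 := mul_nonneg h5 h4
  rw [mul_sub, div_mul_eq_mul_div _ _ (∫ x, ∫ y, _), h3, mul_div_cancel_left₀ _ hN.ne'] at h6
  linarith

lemma exists_feature_real {p m : ℝ} (hp : 0 < p) (hm : IsEnergyBound p (Set.Icc (-1 : ℝ) 1) m) :
    ∃ Φ : ℝ → ℓ²(ℕ, ℝ), Continuous Φ ∧
      ∀ s t, |s| ≤ 1 → |t| ≤ 1 → inner ℝ (Φ s) (Φ t) = m - |s - t| ^ p := by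
  obtain ⟨Φ, hΦ, hin⟩ := hm.exists_feature hp
  have h11 : (-1 : ℝ) ≤ 1 := by norm_num
  refine ⟨fun t => Φ (Set.projIcc (-1) 1 h11 t), hΦ.comp continuous_projIcc,
    fun s t hs ht => ?_⟩
  rw [hin, Subtype.dist_eq, Set.projIcc_of_mem _ (abs_le.1 hs), Set.projIcc_of_mem _ (abs_le.1 ht),
    Real.dist_eq]

/-- An energy bound on the Euclidean ball yields one on the interval. -/
lemma IsEnergyBound.of_closedBall {p C : ℝ} (hp₀ : 0 < p) (hp₂ : p < 2) {n : ℕ} (hn : 1 ≤ n)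
    (hC : IsEnergyBound p (Metric.closedBall (0 : EuclideanSpace ℝ (Fin n)) 1) C) :
    IsEnergyBound p (Set.Icc (-1 : ℝ) 1) (linearMoment n p / normMoment n p * C) := by
  obtain ⟨d, rfl⟩ : ∃ d, n = d + 1 := ⟨n - 1, by omega⟩
  obtain ⟨m, -, hm⟩ := exists_isEnergyBound_Icc hp₀ hp₂
  set b := linearMoment (d + 1) p / normMoment (d + 1) p * C
  rcases le_or_gt m b with hmb | hmb
  · intro ι s x a hx
    refine (hm ι s x a hx).trans ?_
    gcongr
  have hδ : 0 < m - b := sub_pos.2 hmb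
  obtain ⟨Φ, hΦ, hin⟩ := exists_feature_real hp₀ hm
  have hΦ0 : Continuous fun x : EuclideanSpace ℝ (Fin (d + 1)) => Φ (x 0) :=
    hΦ.comp (by fun_prop)
  have hone : Continuous fun _ : EuclideanSpace ℝ (Fin (d + 1)) => (1 : ℝ) := continuous_const
  -- Total mass is dominated by the norm of the averaged feature, so it is represented by a vector
  -- w.
  obtain ⟨w, hw, hwin⟩ := exists_inner_eq_of_abs_le (radialIntegral volume _ hΦ0)
    (radialIntegral volume _ hone) (c := (√(m - b))⁻¹) (by positivity) fun f => by
      have h := sub_mul_sq_le_norm_radialIntegral_sq hp₀ hC hΦ hin f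
      have h1 : radialIntegral volume _ hone f =
          ∫ x : EuclideanSpace ℝ (Fin (d + 1)), f.1 ‖x‖ := by simp [radialIntegral]
      rw [h1, inv_mul_eq_div, le_div_iff₀ (Real.sqrt_pos.2 hδ)]
      refine abs_le_of_sq_le_sq' ?_ (norm_nonneg _) |>.2
      rw [mul_pow, Real.sq_sqrt hδ.le, sq_abs, mul_comm]
      exact h
  have hw2 : ‖w‖ ^ 2 * (m - b) ≤ 1 := by
    have := pow_le_pow_left₀ (norm_nonneg w) hw 2
    rw [inv_pow, Real.sq_sqrt hδ.le] at this
    rwa [← le_div_iff₀ hδ, one_div]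
  -- Radial densities have even marginals, so only the even part of ⟨w, Φ t⟩ can be determined.
  set ψ : ℝ → ℝ := fun t => inner ℝ w (Φ t + Φ (-t)) - 2 with hψdef
  have hψ : Continuous ψ := by fun_prop
  have hψk : ∀ k : ℕ, ∫ x : EuclideanSpace ℝ (Fin (d + 1)),
      max 0 (1 - ‖x‖ ^ 2) ^ (k + 1) * ψ (x 0) = 0 := by
    intro k
    have hi := fun {H : Type} [NormedAddCommGroup H] [NormedSpace ℝ H]
      {J : EuclideanSpace ℝ (Fin (d + 1)) → H} (hJ : Continuous J) =>
      integrable_radialProfile_smul volume (powerProfile k) hJ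
    have h1 := hwin (powerProfile k)
    simp only [radialIntegral, LinearMap.coe_mk, AddHom.coe_mk] at h1
    rw [← integral_inner (hi hΦ0)] at h1
    have hΦ1 : Continuous fun x : EuclideanSpace ℝ (Fin (d + 1)) => Φ (-(x 0)) :=
      hΦ.comp (by fun_prop)
    have h2 : ∫ x : EuclideanSpace ℝ (Fin (d + 1)),
        inner ℝ w ((powerProfile k).1 ‖x‖ • Φ (-(x 0))) =
        ∫ x : EuclideanSpace ℝ (Fin (d + 1)), inner ℝ w ((powerProfile k).1 ‖x‖ • Φ (x 0)) := by
      rw [← integral_neg_eq_self]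
      simp
    have e : ∀ x : EuclideanSpace ℝ (Fin (d + 1)), max 0 (1 - ‖x‖ ^ 2) ^ (k + 1) * ψ (x 0) =
        inner ℝ w ((powerProfile k).1 ‖x‖ • Φ (x 0)) +
          inner ℝ w ((powerProfile k).1 ‖x‖ • Φ (-(x 0))) -
          2 * ((powerProfile k).1 ‖x‖ • (1 : ℝ)) := by
      intro x
      rw [powerProfile_apply, inner_smul_right, inner_smul_right, hψdef]
      simp only [inner_add_right, smul_eq_mul]
      ring
    simp_rw [e]
    have hi₀ := (hi hΦ0).const_inner (𝕜 := ℝ) w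
    have hi₁ := (hi hΦ1).const_inner (𝕜 := ℝ) w
    have hsum := hi₀.add hi₁
    simp only [Pi.add_def] at hsum
    rw [integral_sub hsum ((hi hone).const_mul 2), integral_add hi₀ hi₁, integral_const_mul, h2,
      h1]
    ring
  have hzero : ∀ t, |t| ≤ 1 → ψ t = 0 := by
    intro t ht
    refine eq_zero_of_integral_mul_pow_eq_zero
      -- The last factor absorbs the shift in the exponent k + 1.
      (W := fun t => √(max 0 (1 - t ^ 2)) ^ d * max 0 (1 - t ^ 2)) (by fun_prop)
      (fun t ht => by simp only [max_one_sub_sq_eq_zero ht, mul_zero]) (fun t ht => ?_) hψ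
      (fun t => by simp [hψdef, add_comm]) (fun k => ?_) ht
    · have : 0 < 1 - t ^ 2 := by nlinarith [sq_abs t, abs_nonneg t]
      simp only [max_eq_right this.le]
      positivity
    · have h := hψk k
      rw [integral_max_one_sub_norm_sq_pow_mul d k hψ] at h
      have := (mul_eq_zero.1 h).resolve_left (integral_max_one_sub_sum_sq_pow_pos d k).ne'
      refine Eq.trans ?_ this
      refine integral_congr_ae (.of_forall fun t => ?_)
      simp only
      ring
  intro ι s x a hx
  have hx' : ∀ i, |x i| ≤ 1 := fun i => abs_le.2 (hx i)
  set A := ∑ i ∈ s, a i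
  set I := ∑ i ∈ s, ∑ j ∈ s, a i * a j * dist (x i) (x j) ^ p
  have hnorm : ∀ y : ι → ℝ, (∀ i, |y i| ≤ 1) → (∀ i j, |y i - y j| = |x i - x j|) →
      ‖∑ i ∈ s, a i • Φ (y i)‖ ^ 2 = m * A ^ 2 - I := by
    intro y hy hyx
    refine norm_sum_smul_sq s a (fun i => Φ (y i)) fun i j => ?_
    rw [hin _ _ (hy i) (hy j), hyx, Real.dist_eq]
  have hv := hnorm x hx' fun _ _ => rfl
  have hv' := hnorm (fun i => -x i) (fun i => by rw [abs_neg]; exact hx' i) fun i j => by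
    rw [← abs_neg]; ring_nf
  set v := ∑ i ∈ s, a i • Φ (x i)
  set v' := ∑ i ∈ s, a i • Φ (-x i)
  have hvv : inner ℝ w (v + v') = 2 * A := by
    rw [← Finset.sum_add_distrib, inner_sum, Finset.mul_sum]
    refine Finset.sum_congr rfl fun i _ => ?_
    rw [← smul_add, inner_smul_right]
    have := hzero (x i) (hx' i)
    simp only [hψdef] at this
    rw [sub_eq_zero.1 this]
    ring
  have hcs : (2 * A) ^ 2 ≤ ‖w‖ ^ 2 * ‖v + v'‖ ^ 2 := by
    rw [← hvv, ← mul_pow, ← sq_abs]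
    exact pow_le_pow_left₀ (abs_nonneg _) (abs_real_inner_le_norm w (v + v')) 2
  have hpar := parallelogram_law_with_norm ℝ v v'
  -- Reflecting the points preserves distances, so v and v' have equal norm and the parallelogram
  -- law gives the factor 4, which cancels that of (2A)².
  have h1 : ‖v + v'‖ ^ 2 ≤ 4 * (m * A ^ 2 - I) := by
    nlinarith [mul_self_nonneg ‖v - v'‖]
  have h2 : (2 * A) ^ 2 * (m - b) ≤ ‖v + v'‖ ^ 2 := by
    calc (2 * A) ^ 2 * (m - b) ≤ ‖w‖ ^ 2 * ‖v + v'‖ ^ 2 * (m - b) := by gcongr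
      _ = (‖w‖ ^ 2 * (m - b)) * ‖v + v'‖ ^ 2 := by ring
      _ ≤ 1 * ‖v + v'‖ ^ 2 := by gcongr
      _ = _ := one_mul _
  nlinarith

/-! ### Signed measures and the maximal energy -/

section SignedMeasure

variable {X : Type*} [MeasurableSpace X]

instance (μ : SignedMeasure X) : IsFiniteMeasure μ.variation := by
  rw [← SignedMeasure.totalVariation_eq_variation, SignedMeasure.totalVariation]
  infer_instance

variable [TopologicalSpace X] [OpensMeasurableSpace X] [CompactSpace X]

lemma Continuous.integrable_signedMeasure {H : Type*} [NormedAddCommGroup H] {f : X → H}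
    (hf : Continuous f) (μ : SignedMeasure X) : μ.Integrable f :=
  hf.integrable_of_hasCompactSupport (HasCompactSupport.of_compactSpace f)

/-- The Jordan decomposition reduces this to positive measures. -/
lemma integral_inner_signedMeasure {H : Type*} [NormedAddCommGroup H] [InnerProductSpace ℝ H]
    [CompleteSpace H] {f : X → H} (hf : Continuous f) (μ : SignedMeasure X) (w : H) :
    ∫ᵛ x, inner ℝ w (f x) ∂•μ = inner ℝ w (∫ᵛ x, f x ∂<•μ) := by
  -- Multiplication of reals is symmetric, so the scalar integral may use the flipped pairing too.
  have hflip : (ContinuousLinearMap.lsmul ℝ ℝ : ℝ →L[ℝ] ℝ →L[ℝ] ℝ) =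
      (ContinuousLinearMap.lsmul ℝ ℝ : ℝ →L[ℝ] ℝ →L[ℝ] ℝ).flip := by
    ext
    simp
  rw [hflip]
  have hw : Continuous fun x => inner ℝ w (f x) := by fun_prop
  rw [← μ.toSignedMeasure_toJordanDecomposition, JordanDecomposition.toSignedMeasure,
    VectorMeasure.integral_sub_vectorMeasure (hw.integrable_signedMeasure _)
      (hw.integrable_signedMeasure _),
    VectorMeasure.integral_sub_vectorMeasure (hf.integrable_signedMeasure _)
      (hf.integrable_signedMeasure _), inner_sub_right]
  simp only [VectorMeasure.integral_toSignedMeasure]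
  rw [integral_inner, integral_inner]
  all_goals exact hf.integrable_of_hasCompactSupport (HasCompactSupport.of_compactSpace f)

end SignedMeasure

/-- The energy of a signed measure of mass one in terms of a feature map of the kernel. -/
lemma energyIntegral_eq {E H : Type*} [PseudoMetricSpace E] [SecondCountableTopology E]
    [MeasurableSpace E] [OpensMeasurableSpace E] [NormedAddCommGroup H] [InnerProductSpace ℝ H]
    [CompleteSpace H] {K : Set E} (hK : IsCompact K) {p C : ℝ} {Φ : K → H} (hΦ : Continuous Φ)
    (hin : ∀ x y : K, inner ℝ (Φ x) (Φ y) = C - dist (x : E) y ^ p) (μ : SignedMeasure K)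
    (hμ : μ Set.univ = 1) :
    energyIntegral p K dist μ = C - ‖∫ᵛ x, Φ x ∂<•μ‖ ^ 2 := by
  have : CompactSpace K := isCompact_iff_compactSpace.1 hK
  have hconst : Continuous fun _ : K => C := continuous_const
  have hmass : ∫ᵛ _ : K, C ∂•μ = C := by simp [hμ]
  have key : ∀ w : H, ∫ᵛ x, (C - inner ℝ w (Φ x)) ∂•μ = C - inner ℝ w (∫ᵛ x, Φ x ∂<•μ) := by
    intro w
    have hw : Continuous fun x => inner ℝ w (Φ x) := by fun_prop
    rw [VectorMeasure.integral_fun_sub (hconst.integrable_signedMeasure μ)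
      (hw.integrable_signedMeasure μ), hmass, integral_inner_signedMeasure hΦ]
  have h1 : ∀ x y : K, dist (x : E) y ^ p = C - inner ℝ (Φ y) (Φ x) := fun x y => by
    rw [hin, dist_comm, sub_sub_cancel]
  simp only [energyIntegral, h1, key]
  simp_rw [real_inner_comm (∫ᵛ x, Φ x ∂<•μ)]
  rw [key, real_inner_self_eq_norm_sq]

lemma energyIntegral_le_of_isEnergyBound {E : Type} [PseudoMetricSpace E]
    [SecondCountableTopology E] [MeasurableSpace E] [OpensMeasurableSpace E] {K : Set E}
    (hK : IsCompact K) {p C : ℝ} (hp : 0 < p) (hC : IsEnergyBound p K C) (μ : SignedMeasure K)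
    (hμ : μ Set.univ = 1) : energyIntegral p K dist μ ≤ C := by
  obtain ⟨Φ, hΦ, hin⟩ := hC.exists_feature hp
  rw [energyIntegral_eq hK hΦ hin μ hμ]
  linarith [sq_nonneg ‖∫ᵛ x, Φ x ∂<•μ‖]

lemma isEnergyBound_of_energyIntegral_le {E : Type} [PseudoMetricSpace E]
    [SecondCountableTopology E] [MeasurableSpace E] [BorelSpace E] [T2Space E] {K : Set E}
    (hK : IsCompact K) {p C b : ℝ} (hp : 0 < p) (hC : IsEnergyBound p K C)
    (hb : ∀ μ : SignedMeasure K, μ Set.univ = 1 → energyIntegral p K dist μ ≤ b) :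
    IsEnergyBound p K b := by
  intro ι s x a hx
  have : CompactSpace K := isCompact_iff_compactSpace.1 hK
  rcases eq_or_ne (∑ i ∈ s, a i) 0 with ha | ha
  · rw [ha]
    simpa using hC.sum_nonpos s x a hx ha
  set A := ∑ i ∈ s, a i
  obtain ⟨Φ, hΦ, hin⟩ := hC.exists_feature hp
  let y : ι → K := fun i => ⟨x i, hx i⟩
  -- The normalized discrete measure; mass zero was treated apart because it cannot be normalized.
  let μ : SignedMeasure K := ∑ i ∈ s, VectorMeasure.dirac (y i) (a i / A)
  have hμ : μ Set.univ = 1 := by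
    simp only [μ]
    rw [FunLike.coe_sum, Finset.sum_apply]
    simp only [VectorMeasure.dirac_apply_of_mem MeasurableSet.univ (Set.mem_univ _)]
    rw [← Finset.sum_div, div_self ha]
  have hv : ∫ᵛ x, Φ x ∂<•μ = A⁻¹ • ∑ i ∈ s, a i • Φ (y i) := by
    simp only [μ]
    rw [VectorMeasure.integral_finsetSum_vectorMeasure
      fun i _ => hΦ.integrable_signedMeasure _, Finset.smul_sum]
    refine Finset.sum_congr rfl fun i _ => ?_
    rw [VectorMeasure.integral_dirac]
    simp [smul_smul, div_eq_inv_mul]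
  have h := hb μ hμ
  rw [energyIntegral_eq hK hΦ hin μ hμ, hv, norm_smul, mul_pow,
    norm_sum_smul_sq s a (fun i => Φ (y i)) fun i j => hin _ _, norm_inv, inv_pow,
    Real.norm_eq_abs, sq_abs] at h
  have hA : 0 < A ^ 2 := by positivity
  have h2 := mul_le_mul_of_nonneg_right h hA.le
  rw [sub_mul, mul_right_comm, inv_mul_cancel₀ hA.ne', one_mul] at h2
  simp only [Subtype.dist_eq, y] at h2
  change C * A ^ 2 - (C * A ^ 2 - _) ≤ _ at h2
  linarith

/-- The maximal energy is the least bound for the energies of discrete measures. -/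
lemma maximalEnergy_eq_leastEnergyBound {E : Type} [PseudoMetricSpace E]
    [SecondCountableTopology E] [MeasurableSpace E] [BorelSpace E] [T2Space E] {K : Set E}
    (hK : IsCompact K) (hne : K.Nonempty) {p C : ℝ} (hp : 0 < p) (hC : IsEnergyBound p K C) :
    maximalEnergy p K dist = (leastEnergyBound p K : EReal) := by
  refine le_antisymm (iSup_le fun μ => ?_) ?_
  · exact_mod_cast energyIntegral_le_of_isEnergyBound hK hp hC.isEnergyBound_leastEnergyBound
      μ.1 μ.2
  · by_contra! h
    obtain ⟨b, hb, hbm⟩ := EReal.lt_iff_exists_real_btwn.1 h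
    have hb' : IsEnergyBound p K b := isEnergyBound_of_energyIntegral_le hK hp hC fun μ hμ => by
      have := (le_iSup (fun μ : {μ : SignedMeasure K // μ Set.univ = 1} =>
        (energyIntegral p K dist μ.1 : EReal)) ⟨μ, hμ⟩).trans hb.le
      exact_mod_cast this
    have := leastEnergyBound_le hp hne hb'
    exact absurd (by exact_mod_cast hbm) (not_lt.2 this)

/-! ### Energy bounds and embeddings in spheres -/

section Embedding

variable {E : Type} [PseudoMetricSpace E] {K : Set E} {α : ℝ} {hα₀ : 0 < α} {hα₁ : α ≤ 1}

lemma dist_rpow_two_mul (x y : E) (α : ℝ) : dist x y ^ (2 * α) = (dist x y ^ α) ^ 2 := by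
  rw [mul_comm, Real.rpow_mul dist_nonneg, Real.rpow_two]

/-- Points of the sphere at distance d^α have inner product R² - d^(2α)/2; expanding the squared
norm of ∑ a i • u i, which is nonnegative, gives the bound. -/
lemma isEnergyBound_of_embedsInHilbertSphere {R : ℝ}
    (h : EmbedsInHilbertSphere (Metric.Snowflaking K α hα₀ hα₁) R) :
    IsEnergyBound (2 * α) K (2 * R ^ 2) := by
  obtain ⟨j, hj⟩ := h
  intro ι s x a hx
  let u : ι → ℓ²(ℕ, ℝ) := fun i => j (Metric.Snowflaking.toSnowflaking ⟨x i, hx i⟩)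
  have hu : ∀ i, ‖u i‖ = R := fun i => mem_sphere_zero_iff_norm.1 (j _).2
  have huu : ∀ i k, inner ℝ (u i) (u k) = R ^ 2 - dist (x i) (x k) ^ (2 * α) / 2 := by
    intro i k
    have hd : ‖u i - u k‖ = dist (x i) (x k) ^ α := by
      rw [← dist_eq_norm]
      have := hj.dist_eq (Metric.Snowflaking.toSnowflaking ⟨x i, hx i⟩)
        (Metric.Snowflaking.toSnowflaking ⟨x k, hx k⟩)
      rwa [Metric.Snowflaking.dist_toSnowflaking_toSnowflaking] at this
    have := norm_sub_sq_real (u i) (u k)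
    rw [hd, hu, hu, ← dist_rpow_two_mul] at this
    linarith
  have h := norm_sum_smul_sq s a u huu
  have e : ∑ i ∈ s, ∑ j ∈ s, a i * a j * (dist (x i) (x j) ^ (2 * α) / 2) =
      (∑ i ∈ s, ∑ j ∈ s, a i * a j * dist (x i) (x j) ^ (2 * α)) / 2 := by
    simp_rw [Finset.sum_div, mul_div_assoc]
  rw [e] at h
  nlinarith [sq_nonneg ‖∑ i ∈ s, a i • u i‖]

/-- Feature vectors have squared norm C and squared distance 2 d^(2α), so division by √2 gives the
right distances and the radius. -/
lemma embedsInHilbertSphere_of_isEnergyBound [SecondCountableTopology E] {C : ℝ}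
    (hC : IsEnergyBound (2 * α) K C) :
    EmbedsInHilbertSphere (Metric.Snowflaking K α hα₀ hα₁) (√(C / 2)) := by
  have hp : 0 < 2 * α := by linarith
  obtain ⟨Φ, -, hin⟩ := hC.exists_feature hp
  have hs : (√2)⁻¹ ^ 2 = (1 / 2 : ℝ) := by simp
  have hin' : ∀ x y, inner ℝ ((√2)⁻¹ • Φ x) ((√2)⁻¹ • Φ y) =
      C / 2 - (dist x y ^ α) ^ 2 / 2 := by
    intro x y
    rw [inner_smul_left, inner_smul_right, hin, dist_rpow_two_mul, ← mul_assoc]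
    simp only [conj_trivial]
    rw [← pow_two, hs]
    ring
  have hn : ∀ x, ‖(√2)⁻¹ • Φ x‖ ^ 2 = C / 2 := fun x => by
    rw [← real_inner_self_eq_norm_sq, hin', dist_self, Real.zero_rpow hα₀.ne']
    simp
  refine ⟨fun x => ⟨(√2)⁻¹ • Φ x.ofSnowflaking, ?_⟩, Isometry.of_dist_eq fun x y => ?_⟩
  · rw [mem_sphere_zero_iff_norm, ← hn x.ofSnowflaking, Real.sqrt_sq (norm_nonneg _)]
  · obtain ⟨x, rfl⟩ := Metric.Snowflaking.toSnowflaking.surjective x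
    obtain ⟨y, rfl⟩ := Metric.Snowflaking.toSnowflaking.surjective y
    rw [Subtype.dist_eq, dist_eq_norm, Metric.Snowflaking.dist_toSnowflaking_toSnowflaking,
      ← sq_eq_sq₀ (norm_nonneg _) (Real.rpow_nonneg dist_nonneg _), norm_sub_sq_real]
    simp only [Metric.Snowflaking.ofSnowflaking_toSnowflaking]
    rw [hn, hn, hin']
    ring

lemma EmbedsInHilbertSphere.radius_nonneg {X : Type*} [PseudoMetricSpace X] [Nonempty X] {R : ℝ}
    (h : EmbedsInHilbertSphere X R) : 0 ≤ R := by
  obtain ⟨j, -⟩ := h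
  rw [← mem_sphere_zero_iff_norm.1 (j (Classical.arbitrary X)).2]
  exact norm_nonneg _

end Embedding

/-! ### Asymptotics of Gamma ratios -/

/-- Wendel's upper bound for the ratio of Gamma functions. -/
lemma Gamma_add_le_rpow_mul_Gamma {x α : ℝ} (hx : 0 < x) (hα₀ : 0 < α) (hα₁ : α < 1) :
    Real.Gamma (x + α) ≤ x ^ α * Real.Gamma x := by
  have hG := Real.Gamma_pos_of_pos hx
  have h := Real.Gamma_mul_add_mul_le_rpow_Gamma_mul_rpow_Gamma (s := x) (t := x + 1)
    (a := 1 - α) (b := α) hx (by linarith) (by linarith) hα₀ (by ring)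
  rw [show (1 - α) * x + α * (x + 1) = x + α by ring, Real.Gamma_add_one hx.ne',
    Real.mul_rpow hx.le hG.le, mul_left_comm, ← Real.rpow_add hG] at h
  simpa using h

/-- Wendel's lower bound for the ratio of Gamma functions. -/
lemma rpow_mul_Gamma_le_Gamma_add {x α : ℝ} (hx : 0 < x) (hα₀ : 0 < α) (hα₁ : α < 1) :
    x * (x + α) ^ (α - 1) * Real.Gamma x ≤ Real.Gamma (x + α) := by
  have hxα : 0 < x + α := by linarith
  have h := Gamma_add_le_rpow_mul_Gamma hxα (α := 1 - α) (by linarith) (by linarith)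
  rw [show x + α + (1 - α) = x + 1 by ring, Real.Gamma_add_one hx.ne'] at h
  have h1 := mul_le_mul_of_nonneg_left h (Real.rpow_nonneg hxα.le (α - 1))
  rw [← mul_assoc, ← mul_assoc, ← Real.rpow_add hxα] at h1
  simp only [sub_add_sub_cancel, sub_self, Real.rpow_zero, one_mul] at h1
  linarith

lemma tendsto_Gamma_add_div {α : ℝ} (hα₀ : 0 < α) (hα₁ : α < 1) :
    Tendsto (fun x : ℝ => Real.Gamma (x + α) / (x ^ α * Real.Gamma x)) atTop (𝓝 1) := by
  have hlim : Tendsto (fun x : ℝ => (1 + α / x) ^ (α - 1)) atTop (𝓝 1) := by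
    have h1 : Tendsto (fun x : ℝ => 1 + α / x) atTop (𝓝 1) := by
      simpa using (tendsto_const_nhds (x := (1 : ℝ))).add
        (tendsto_const_nhds (x := α) |>.div_atTop tendsto_id)
    simpa using h1.rpow_const (p := α - 1) (.inl one_ne_zero)
  refine tendsto_of_tendsto_of_tendsto_of_le_of_le' hlim tendsto_const_nhds ?_ ?_
  · filter_upwards [eventually_gt_atTop 0] with x hx
    have hG := Real.Gamma_pos_of_pos hx
    have hxα : 0 < x ^ α := Real.rpow_pos_of_pos hx _
    rw [le_div_iff₀ (by positivity)]
    refine le_trans (le_of_eq ?_) (rpow_mul_Gamma_le_Gamma_add hx hα₀ hα₁)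
    rw [show x + α = x * (1 + α / x) by field_simp, Real.mul_rpow hx.le (by positivity),
      Real.rpow_sub_one hx.ne']
    field_simp
  · filter_upwards [eventually_gt_atTop 0] with x hx
    have hG := Real.Gamma_pos_of_pos hx
    have hxα : 0 < x ^ α := Real.rpow_pos_of_pos hx _
    rw [div_le_one (by positivity)]
    exact Gamma_add_le_rpow_mul_Gamma hx hα₀ hα₁

/-- The asymptotics of the radii. -/
lemma tendsto_sqrt_Gamma_ratio_div {α : ℝ} (hα₀ : 0 < α) (hα₁ : α < 1) (c : ℝ) :
    Tendsto (fun n : ℕ => √(c * Real.Gamma (α + n / 2) /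
      (2 * Real.Gamma (α + 1 / 2) * Real.Gamma (n / 2))) / (n : ℝ) ^ (α / 2)) atTop
      (𝓝 (√(c / (2 ^ (1 + α) * Real.Gamma (α + 1 / 2))))) := by
  have h2 : Tendsto (fun n : ℕ => (n : ℝ) / 2) atTop atTop :=
    tendsto_natCast_atTop_atTop.atTop_div_const (by norm_num)
  -- At x = n/2 the normalizing power is n^α / 2^α, which together with the factor 2 produces
  -- 2^(1+α).
  have h := ((tendsto_Gamma_add_div hα₀ hα₁).comp h2).const_mul
    (c / (2 ^ (1 + α) * Real.Gamma (α + 1 / 2)))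
  rw [mul_one] at h
  refine (h.sqrt).congr' ?_
  filter_upwards [eventually_gt_atTop 0] with n hn
  have hn' : (0 : ℝ) < n := by exact_mod_cast hn
  have hG := Real.Gamma_pos_of_pos (show (0 : ℝ) < n / 2 by positivity)
  have hα := Real.Gamma_pos_of_pos (show 0 < α + 1 / 2 by positivity)
  have hnα : 0 < (n : ℝ) ^ α := Real.rpow_pos_of_pos hn' _
  have h2α : (0 : ℝ) < 2 ^ α := by positivity
  have e : (n : ℝ) ^ (α / 2) = √((n : ℝ) ^ α) := by
    rw [Real.sqrt_eq_rpow, ← Real.rpow_mul hn'.le]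
    ring_nf
  rw [e, ← Real.sqrt_div' _ hnα.le, Function.comp, Real.div_rpow hn'.le (by norm_num),
    Real.rpow_add (by norm_num), Real.rpow_one, add_comm (n / 2 : ℝ)]
  congr 1
  field_simp

/-! ### The smallest radius -/

theorem theorem2p14 (α : ℝ) (hα₀ : 0 < α) (hα₁ : α < 1) :
    ∃ m : ℝ, intervalMaximalEnergy (2 * α) = (m : EReal) ∧
      (∀ n : ℕ, 1 ≤ n →
        IsLeast {R : ℝ | EmbedsInHilbertSphere (SnowflakedBall n α hα₀ hα₁) R}
          (√(m * Real.pi ^ (1 / 2 : ℝ) * Real.Gamma (α + n / 2) /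
            (2 * Real.Gamma (α + 1 / 2) * Real.Gamma (n / 2))))) ∧
      ∃ ε : ℕ → ℝ, Tendsto ε atTop (𝓝 0) ∧ ∀ n : ℕ, 1 ≤ n →
        √(m * Real.pi ^ (1 / 2 : ℝ) * Real.Gamma (α + n / 2) /
            (2 * Real.Gamma (α + 1 / 2) * Real.Gamma (n / 2))) =
          (n : ℝ) ^ (α / 2) *
            (√(m * Real.pi ^ (1 / 2 : ℝ) / (2 ^ (1 + α) * Real.Gamma (α + 1 / 2))) + ε n) := by
  have hp₀ : 0 < 2 * α := by linarith
  have hp₂ : 2 * α < 2 := by linarith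
  obtain ⟨C, -, hC⟩ := exists_isEnergyBound_Icc hp₀ hp₂
  have hne : (Set.Icc (-1 : ℝ) 1).Nonempty := ⟨0, by norm_num, by norm_num⟩
  set m := leastEnergyBound (2 * α) (Set.Icc (-1 : ℝ) 1)
  have hm : IsEnergyBound (2 * α) (Set.Icc (-1 : ℝ) 1) m := hC.isEnergyBound_leastEnergyBound
  refine ⟨m, maximalEnergy_eq_leastEnergyBound isCompact_Icc hne hp₀ hC, fun n hn => ?_, ?_⟩
  · have hL := linearMoment_pos n hp₀
    have hN := normMoment_pos hn hp₀
    have e : m * Real.pi ^ (1 / 2 : ℝ) * Real.Gamma (α + n / 2) /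
        (2 * Real.Gamma (α + 1 / 2) * Real.Gamma (n / 2)) =
        m * (normMoment n (2 * α) / linearMoment n (2 * α)) / 2 := by
      rw [normMoment_div_linearMoment hn]
      ring
    rw [e]
    refine ⟨embedsInHilbertSphere_of_isEnergyBound (hm.closedBall hp₀ hn), fun R hR => ?_⟩
    have hR : EmbedsInHilbertSphere (SnowflakedBall n α hα₀ hα₁) R := hR
    have : Nonempty (SnowflakedBall n α hα₀ hα₁) :=
      ⟨Metric.Snowflaking.toSnowflaking ⟨0, by simp⟩⟩
    -- A radius R makes 2R² a bound on the ball, hence (L/N)·2R² one on the interval, which is at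
    -- least m.
    have h := leastEnergyBound_le hp₀ hne
      ((isEnergyBound_of_embedsInHilbertSphere hR).of_closedBall hp₀ hp₂ hn)
    rw [div_mul_eq_mul_div, le_div_iff₀ hN] at h
    refine Real.sqrt_le_iff.2 ⟨hR.radius_nonneg, ?_⟩
    rw [div_le_iff₀ (by norm_num), ← mul_div_assoc, div_le_iff₀ hL]
    linarith
  · refine ⟨fun n => √(m * Real.pi ^ (1 / 2 : ℝ) * Real.Gamma (α + n / 2) /
        (2 * Real.Gamma (α + 1 / 2) * Real.Gamma (n / 2))) / (n : ℝ) ^ (α / 2) -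
        √(m * Real.pi ^ (1 / 2 : ℝ) / (2 ^ (1 + α) * Real.Gamma (α + 1 / 2))), ?_, fun n hn => ?_⟩
    · simpa using (tendsto_sqrt_Gamma_ratio_div hα₀ hα₁ (m * Real.pi ^ (1 / 2 : ℝ))).sub_const
        (√(m * Real.pi ^ (1 / 2 : ℝ) / (2 ^ (1 + α) * Real.Gamma (α + 1 / 2))))
    · have hn' : (0 : ℝ) < (n : ℝ) ^ (α / 2) := Real.rpow_pos_of_pos (by exact_mod_cast hn) _
      rw [add_sub_cancel, mul_div_cancel₀ _ hn'.ne']
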